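/- Let $0<\beta<\gamma<1$, $0\le\mu\le1$, $p>1/\beta$, $K\ge 0$ and $x_0\in\mathbb{R}$. Let $l,k:(0,\infty)\to[0,\infty)$ be such that the functions $t\mapsto t^{(1-\mu)(1-\beta)}l(t)$ and $t\mapsto t^{1-\beta}k(t)$ are continuous on $(0,\infty)$ and belong to $L^p(0,T)$ for every $T>0$, and such that $t^{\gamma}l(t)\le K$ and $t^{\gamma}k(t)\le K$ for all $t\ge 1$. Let $f:(0,\infty)\times\mathbb{R}\to\mathbb{R}$ be continuous with $$|f(t,x)|\le l(t)|x|^{\mu}+k(t)\qquad\text{for all }(t,x)\in(0,\infty)\times\mathbb{R},$$ where $|x|^0=1$ for all $x$, including $x=0$. Then the Riemann–Liouville initial value problem $$D_{0^+}^{\beta}x(t)=f(t,x(t))\quad(t>0),\qquad \lim_{t\to0^+}t^{1-\beta}x(t)=x_0,$$ has at least one solution $x\in C_{1-\beta}(0,\infty)$ such that $\lim_{t\to\infty}x(t)=0$. Here $C_{1-\beta}(0,\infty)$ is the set of continuous $x:(0,\infty)\to\mathbb{R}$ for which $t^{1-\beta}x(t)$ extends to a continuous function on $[0,\infty)$, and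 $$D_{0^+}^{\beta}x(t)=\frac{d}{dt}I_{0^+}^{1-\beta}x(t),\qquad I_{0^+}^{1-\beta}x(t)=\frac{1}{\Gamma(1-\beta)}\int_0^t\frac{x(s)}{(t-s)^{\beta}}\,ds .$$ A solution is understood to be integrable on $(0,T]$ with $I_{0^+}^{1-\beta}x$ absolutely continuous on $(0,T]$ for every $T>0$, the differential equation holding at every $t>0$. -/

import Mathlib

open MeasureTheory Set Filter Topology

/-- The Riemann–Liouville fractional integral of order `α`,
`I^α ρ (t) = (1 / Γ(α)) ∫₀ᵗ ρ(s) / (t - s)^(1 - α) ds`. -/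
noncomputable def rlIntegral (α : ℝ) (ρ : ℝ → ℝ) (t : ℝ) : ℝ :=
  (1 / Real.Gamma α) * ∫ s in (0 : ℝ)..t, ρ s / (t - s) ^ (1 - α)

/-- `x` has on `(0, ∞)` the Riemann–Liouville fractional derivative `g` of order `β`:
`x` is integrable on every `(0, T]`, the fractional integral `I^(1-β) x` is absolutely continuous
on every `(0, T]`, and its derivative at every `t > 0` is `g t`.
Absolute continuity on the half-open interval `(0, T]` is expressed by an absolutely continuous
extension to `[0, T]`; the value of that extension at `0` is the limit of `I^(1-β) x` at `0+`,
which need not be the value `0` of the integral over the empty interval. -/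
structure HasRLDerivOn (β : ℝ) (x g : ℝ → ℝ) : Prop where
  integrableOn : ∀ T : ℝ, 0 < T → IntegrableOn x (Ioc 0 T)
  absolutelyContinuous : ∃ F : ℝ → ℝ, (∀ t : ℝ, 0 < t → F t = rlIntegral (1 - β) x t) ∧
    ∀ T : ℝ, 0 < T → AbsolutelyContinuousOnInterval F 0 T
  hasDerivAt : ∀ t : ℝ, 0 < t → HasDerivAt (rlIntegral (1 - β) x) (g t) t

/-- `x` solves the initial value problem `D^β x(t) = f(t, x(t))` for `t ∈ (0, ∞)`,
`lim_{t → 0+} t^(1-β) x(t) = x₀`. -/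
structure IsRLSolution (β : ℝ) (f : ℝ → ℝ → ℝ) (x₀ : ℝ) (x : ℝ → ℝ) : Prop where
  equation : HasRLDerivOn β x (fun t => f t (x t))
  initial : Tendsto (fun t : ℝ => t ^ (1 - β) * x t) (𝓝[>] 0) (𝓝 x₀)

/-- The space `C_α(0, ∞)`: functions continuous on `(0, ∞)` for which `t^α x(t)` is
(that is, extends to) a continuous function on `[0, ∞)`. -/
def WeightedC (α : ℝ) : Set (ℝ → ℝ) :=
  {x | ContinuousOn x (Ioi 0) ∧
    ∃ g : ℝ → ℝ, ContinuousOn g (Ici 0) ∧ ∀ t : ℝ, 0 < t → g t = t ^ α * x t}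

/-- The space `C(0, ∞) ∩ L^p_Loc[0, ∞)`. -/
def ContLpLoc (p : ℝ) : Set (ℝ → ℝ) :=
  {g | ContinuousOn g (Ioi 0) ∧
    ∀ T : ℝ, 0 < T → MemLp g (ENNReal.ofReal p) (volume.restrict (Icc 0 T))}

/-! Writing `x t = t ^ (β - 1) * y t` turns the problem into the Volterra equation `y t = x₀ + t ^
(1 - β) / Γ(β) * ∫₀ᵗ (t - s) ^ (β - 1) * g s (y s) ds` with `g s y = f s (s ^ (β - 1) * y)`. Since
`|u| ^ μ ≤ 1 + |u|`, the growth condition becomes `|g s y| ≤ w s * (1 + |y|)`, where `w s = s ^ (β -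
1) * M s` and `M` is locally in `L^p` up to `0`. As `p > 1 / β`, Hölder's inequality bounds the
fractional integral of `w` even for an order `a` slightly below `β`; `AdmissibleWeight` records this
slack.

Existence needs no uniqueness and no fixed point theorem. Delaying the unknown by `δ > 0` makes the
equation explicit, solvable on successive intervals of length `δ` (`exists_delayed_solution`). The
slack `β - a` gives an exponential bound independent of `δ` (`exists_invariant_bound`), and the
Hölder continuity of the kernel gives a common modulus of continuity (`delayOp_modulus`).
Arzelà–Ascoli extracts a limit as `δ → 0`, and dominated convergence shows that it solves the
undelayed equation. The semigroup law `I^(1-β) I^β = I^1` (`fracInt_comp`) then turns the integral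
equation back into the differential one.

For the decay, `|f t (x t)| ≤ K * t ^ (-γ) * (2 + |x t|)` when `t ≥ 1`, so the part of the integral
over `[1, t]` is at most a multiple of `t ^ (β - γ)` times `2` plus the running maximum of `|x|`. As
`β < γ` this factor vanishes, which first bounds `x` and then forces it to `0`
(`tendsto_zero_of_le_running_bound`). -/

/-- The fractional integral of order `a`, without the factor `1 / Γ(a)`. -/
noncomputable def fracInt (a : ℝ) (h : ℝ → ℝ) (t : ℝ) : ℝ :=
  ∫ s in (0 : ℝ)..t, (t - s) ^ (a - 1) * h s

/-! ### Estimates for fractional kernels. -/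

lemma intervalIntegrable_sub_rpow {r : ℝ} (hr : -1 < r) (c a b : ℝ) :
    IntervalIntegrable (fun s : ℝ => (c - s) ^ r) volume a b := by
  have h := (intervalIntegral.intervalIntegrable_rpow' (a := c - a) (b := c - b) hr).comp_sub_left c
  simpa using h

lemma integral_sub_rpow {r : ℝ} (hr : -1 < r) (c a b : ℝ) :
    ∫ s in a..b, (c - s) ^ r = ((c - a) ^ (r + 1) - (c - b) ^ (r + 1)) / (r + 1) := by
  rw [intervalIntegral.integral_comp_sub_left (fun x : ℝ => x ^ r) c, integral_rpow (Or.inl hr)]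

/-- Hölder's inequality on `(0, t]` for a kernel whose `q`-th power has the integral of `s ^ r`. -/
lemma holder_kernel {p q T t a : ℝ} (hpq : p.HolderConjugate q) (ha : 1 / p < a)
    (ht : 0 < t) (htT : t ≤ T) {φ M : ℝ → ℝ} (hφm : Measurable φ)
    (hφ0 : ∀ s ∈ Ioc 0 t, 0 ≤ φ s)
    (hφi : IntervalIntegrable (fun s => φ s ^ q) volume 0 t)
    (hφe : ∫ s in (0 : ℝ)..t, φ s ^ q = t ^ (q * (a - 1) + 1) / (q * (a - 1) + 1))
    (hM0 : ∀ s, 0 < s → 0 ≤ M s)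
    (hM : MemLp M (ENNReal.ofReal p) (volume.restrict (Icc 0 T))) :
    IntegrableOn (fun s => φ s * M s) (Ioc 0 t) ∧
    ∫ s in Ioc 0 t, φ s * M s ≤ (1 / (q * (a - 1) + 1)) ^ (1 / q) *
      (∫ s in Ioc 0 T, M s ^ p) ^ (1 / p) * t ^ (a - 1 / p) := by
  have hq := hpq.symm.pos
  have hp := hpq.pos
  have hinv : 1 / p + 1 / q = 1 := by simpa using hpq.inv_add_inv_eq_one
  have hr : 0 < q * (a - 1) + 1 := by
    have h1 : 0 < q * (a - 1 / p) := mul_pos hq (by linarith)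
    have h2 : q * (1 / q) = 1 := by field_simp
    nlinarith
  have hsub : Ioc 0 t ⊆ Icc 0 T := fun s hs => ⟨hs.1.le, hs.2.trans htT⟩
  have hMt : MemLp M (ENNReal.ofReal p) (volume.restrict (Ioc 0 t)) :=
    hM.mono_measure (Measure.restrict_mono hsub le_rfl)
  have hφL : MemLp φ (ENNReal.ofReal q) (volume.restrict (Ioc 0 t)) := by
    rw [← integrable_norm_rpow_iff hφm.aestronglyMeasurable (by simpa using hq) (by simp),
      ENNReal.toReal_ofReal hq.le]
    have := (intervalIntegrable_iff_integrableOn_Ioc_of_le ht.le).1 hφi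
    refine this.congr_fun (fun s hs => ?_) measurableSet_Ioc
    simp only [Real.norm_of_nonneg (hφ0 s hs)]
  have hφ0' : 0 ≤ᵐ[volume.restrict (Ioc 0 t)] φ :=
    (ae_restrict_iff' measurableSet_Ioc).2 (ae_of_all _ hφ0)
  have hM0' : 0 ≤ᵐ[volume.restrict (Ioc 0 t)] M :=
    (ae_restrict_iff' measurableSet_Ioc).2 (ae_of_all _ fun s hs => hM0 s hs.1)
  have hconj : ENNReal.HolderConjugate (ENNReal.ofReal q) (ENNReal.ofReal p) :=
    hpq.symm.ennrealOfReal
  refine ⟨hφL.integrable_mul hMt, ?_⟩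
  refine (integral_mul_le_Lp_mul_Lq_of_nonneg hpq.symm hφ0' hM0' hφL hMt).trans ?_
  rw [← intervalIntegral.integral_of_le ht.le, hφe]
  have hMi : IntegrableOn (fun s => M s ^ p) (Ioc 0 T) := by
    have h1 : MemLp M (ENNReal.ofReal p) (volume.restrict (Ioc 0 T)) :=
      hM.mono_measure (Measure.restrict_mono Ioc_subset_Icc_self le_rfl)
    have := h1.integrable_norm_rpow (by simpa using hp) (by simp)
    rw [ENNReal.toReal_ofReal hp.le] at this
    refine IntegrableOn.congr_fun this (fun s hs => ?_) measurableSet_Ioc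
    simp only [Real.norm_of_nonneg (hM0 s hs.1)]
  have hmono : ∫ s in Ioc 0 t, M s ^ p ≤ ∫ s in Ioc 0 T, M s ^ p := by
    refine setIntegral_mono_set hMi ?_ (Ioc_subset_Ioc_right htT).eventuallyLE
    exact (ae_restrict_iff' measurableSet_Ioc).2
      (ae_of_all _ fun s hs => Real.rpow_nonneg (hM0 s hs.1) _)
  have hMt0 : 0 ≤ ∫ s in Ioc 0 t, M s ^ p :=
    setIntegral_nonneg measurableSet_Ioc fun s hs => Real.rpow_nonneg (hM0 s hs.1) _
  have he : (t ^ (q * (a - 1) + 1) / (q * (a - 1) + 1)) ^ (1 / q)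
      = (1 / (q * (a - 1) + 1)) ^ (1 / q) * t ^ (a - 1 / p) := by
    rw [div_eq_mul_one_div, Real.mul_rpow (by positivity) (by positivity), ← Real.rpow_mul ht.le,
      mul_comm]
    congr 2
    field_simp
    field_simp at hinv
    nlinarith
  rw [he]
  have : (∫ s in Ioc 0 t, M s ^ p) ^ (1 / p) ≤ (∫ s in Ioc 0 T, M s ^ p) ^ (1 / p) :=
    Real.rpow_le_rpow hMt0 hmono (by positivity)
  calc _ ≤ (1 / (q * (a - 1) + 1)) ^ (1 / q) * t ^ (a - 1 / p) *
        (∫ s in Ioc 0 T, M s ^ p) ^ (1 / p) := by gcongr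
    _ = _ := by ring

/-- A pointwise bound separating the two singularities of a fractional kernel. -/
lemma kernel_split {a b s t : ℝ} (ha : 0 < a) (hab : a ≤ b) (hb : b < 1) (hs : 0 < s)
    (hst : s < t) :
    t ^ (1 - b) * ((t - s) ^ (a - 1) * s ^ (b - 1)) ≤ 2 * (t - s) ^ (a - 1) + 2 * s ^ (a - 1) := by
  have ht : 0 < t := hs.trans hst
  have hts : 0 < t - s := by linarith
  have h2 : ∀ e : ℝ, 0 ≤ e → e ≤ 1 → (2 : ℝ) ^ e ≤ 2 := fun e _ he => by
    simpa using Real.rpow_le_rpow_of_exponent_le (by norm_num : (1 : ℝ) ≤ 2) he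
  -- For `s ≥ t / 2` the weight `s ^ (b - 1)` is comparable to `t ^ (b - 1)`; for `s ≤ t / 2` the
  -- kernel is comparable to `t ^ (a - 1)`, and `a ≤ b` lets `t ^ (a - b)` be replaced by `s ^ (a -
  -- b)`.
  rcases le_total (t / 2) s with h | h
  · have h1 : t ^ (1 - b) * s ^ (b - 1) ≤ 2 := by
      calc t ^ (1 - b) * s ^ (b - 1) ≤ (2 * s) ^ (1 - b) * s ^ (b - 1) := by
            gcongr
            · linarith
        _ = 2 ^ (1 - b) := by
            rw [Real.mul_rpow (by norm_num) hs.le, mul_assoc, ← Real.rpow_add hs]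
            simp
        _ ≤ 2 := h2 _ (by linarith) (by linarith)
    have h3 : 0 ≤ (t - s) ^ (a - 1) := by positivity
    have h4 : 0 ≤ s ^ (a - 1) := by positivity
    nlinarith
  · have h1 : (t - s) ^ (a - 1) ≤ 2 * t ^ (a - 1) := by
      calc (t - s) ^ (a - 1) ≤ (t / 2) ^ (a - 1) :=
            Real.rpow_le_rpow_of_nonpos (by positivity) (by linarith) (by linarith)
        _ = 2 ^ (1 - a) * t ^ (a - 1) := by
            rw [Real.div_rpow ht.le (by norm_num), ← neg_sub a 1, Real.rpow_neg (by norm_num)]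
            field_simp
        _ ≤ 2 * t ^ (a - 1) := by
            gcongr
            exact h2 _ (by linarith) (by linarith)
    have h3 : 0 ≤ (t - s) ^ (a - 1) := by positivity
    have h5 : t ^ (1 - b) * (t ^ (a - 1) * s ^ (b - 1)) ≤ s ^ (a - 1) := by
      calc t ^ (1 - b) * (t ^ (a - 1) * s ^ (b - 1)) = t ^ (a - b) * s ^ (b - 1) := by
            rw [← mul_assoc, ← Real.rpow_add ht]; ring_nf
        _ ≤ s ^ (a - b) * s ^ (b - 1) := by
            gcongr ?_ * _
            exact Real.rpow_le_rpow_of_nonpos hs hst.le (by linarith)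
        _ = s ^ (a - 1) := by rw [← Real.rpow_add hs]; ring_nf
    calc _ ≤ t ^ (1 - b) * (2 * t ^ (a - 1) * s ^ (b - 1)) := by gcongr
      _ = 2 * (t ^ (1 - b) * (t ^ (a - 1) * s ^ (b - 1))) := by ring
      _ ≤ 2 * s ^ (a - 1) := by gcongr
      _ ≤ _ := by linarith

/-- After `kernel_split` each term has a single singularity, whose `q`-th power is integrable
exactly because `a > 1 / p`, so Hölder applies to each term separately. -/
lemma weighted_fracInt_bound {p T a b : ℝ} (hp : 1 < p) (ha : 1 / p < a) (hab : a ≤ b)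
    (hb : b < 1) {M : ℝ → ℝ}
    (hM0 : ∀ s, 0 < s → 0 ≤ M s)
    (hM : MemLp M (ENNReal.ofReal p) (volume.restrict (Icc 0 T))) :
    ∃ C : ℝ, 0 ≤ C ∧ ∀ t, 0 < t → t ≤ T →
      IntegrableOn (fun s => (t - s) ^ (a - 1) * (s ^ (b - 1) * M s)) (Ioc 0 t) ∧
      IntegrableOn (fun s => s ^ (b - 1) * M s) (Ioc 0 t) ∧
      t ^ (1 - b) * fracInt a (fun s => s ^ (b - 1) * M s) t ≤ C * t ^ (a - 1 / p) := by
  have hpq := Real.HolderConjugate.conjExponent hp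
  set q := p.conjExponent
  have hq := hpq.symm.pos
  have hinv : 1 / p + 1 / q = 1 := by simpa using hpq.inv_add_inv_eq_one
  have hp0 : 0 < 1 / p := by positivity
  have hr : ∀ a, 1 / p < a → 0 < q * (a - 1) + 1 := fun a ha => by
    have h1 : 0 < q * (a - 1 / p) := mul_pos hq (by linarith)
    have h2 : q * (1 / q) = 1 := by field_simp
    nlinarith
  -- The order is left free: it is `a` in the estimate, and `b` for the integrability of the weight
  -- itself.
  have key1 := fun (a t : ℝ) (ha : 1 / p < a) (ht : 0 < t) (htT : t ≤ T) =>
    holder_kernel (φ := fun s => s ^ (a - 1)) hpq ha ht htT (by fun_prop)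
    (fun s hs => Real.rpow_nonneg hs.1.le _) (by
      have h := intervalIntegral.intervalIntegrable_rpow' (a := 0) (b := t)
        (r := q * (a - 1)) (by linarith [hr a ha])
      refine h.congr fun s hs => ?_
      rw [uIoc_of_le ht.le] at hs
      simp only [← Real.rpow_mul hs.1.le, mul_comm]) (by
      have h : ∫ s in (0 : ℝ)..t, (s ^ (a - 1)) ^ q = ∫ s in (0 : ℝ)..t, s ^ (q * (a - 1)) := by
        refine intervalIntegral.integral_congr fun s hs => ?_
        rw [uIcc_of_le ht.le] at hs
        simp only [← Real.rpow_mul hs.1, mul_comm]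
      rw [h, integral_rpow (Or.inl (by linarith [hr a ha])), Real.zero_rpow (hr a ha).ne',
        sub_zero]) hM0 hM
  have key2 := fun (t : ℝ) (ht : 0 < t) (htT : t ≤ T) =>
    holder_kernel (φ := fun s => (t - s) ^ (a - 1)) hpq ha ht htT (by fun_prop)
    (fun s hs => Real.rpow_nonneg (by linarith [hs.2]) _) (by
      have h := intervalIntegrable_sub_rpow (r := q * (a - 1)) (by linarith [hr a ha]) t 0 t
      refine h.congr fun s hs => ?_
      rw [uIoc_of_le ht.le] at hs
      simp only [← Real.rpow_mul (sub_nonneg.2 hs.2), mul_comm]) (by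
      have h : ∫ s in (0 : ℝ)..t, ((t - s) ^ (a - 1)) ^ q
          = ∫ s in (0 : ℝ)..t, (t - s) ^ (q * (a - 1)) := by
        refine intervalIntegral.integral_congr fun s hs => ?_
        rw [uIcc_of_le ht.le] at hs
        simp only [← Real.rpow_mul (sub_nonneg.2 hs.2), mul_comm]
      rw [h, integral_sub_rpow (by linarith [hr a ha]), sub_self, Real.zero_rpow (hr a ha).ne',
        sub_zero, sub_zero]) hM0 hM
  set D := (1 / (q * (a - 1) + 1)) ^ (1 / q) * (∫ s in Ioc 0 T, M s ^ p) ^ (1 / p) with hD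
  have hD0 : 0 ≤ D := by
    have := hr a ha
    have : 0 ≤ ∫ s in Ioc 0 T, M s ^ p :=
      setIntegral_nonneg measurableSet_Ioc fun s hs => Real.rpow_nonneg (hM0 s hs.1) _
    positivity
  refine ⟨4 * D, by positivity, fun t ht htT => ?_⟩
  obtain ⟨i1, e1⟩ := key1 a t ha ht htT
  obtain ⟨i2, e2⟩ := key2 t ht htT
  have i3 := (key1 b t (ha.trans_le hab) ht htT).1
  have hmeas : AEStronglyMeasurable (fun s => (t - s) ^ (a - 1) * (s ^ (b - 1) * M s))
      (volume.restrict (Ioc 0 t)) := by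
    refine AEStronglyMeasurable.mul (Measurable.aestronglyMeasurable (by fun_prop)) i3.1
  have hne : ∀ᵐ s : ℝ ∂volume, s ≠ t := by
    simp [ae_iff, measure_singleton]
  have hpt : ∀ᵐ s ∂(volume.restrict (Ioc 0 t)),
      t ^ (1 - b) * ((t - s) ^ (a - 1) * (s ^ (b - 1) * M s)) ≤
      2 * ((t - s) ^ (a - 1) * M s) + 2 * (s ^ (a - 1) * M s) := by
    refine (ae_restrict_iff' measurableSet_Ioc).2 ?_
    filter_upwards [hne] with s hs hs'
    have := kernel_split (hp0.trans ha) hab hb hs'.1 (lt_of_le_of_ne hs'.2 hs)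
    have := mul_le_mul_of_nonneg_right this (hM0 s hs'.1)
    linarith
  have hint : IntegrableOn (fun s => t ^ (1 - b) * ((t - s) ^ (a - 1) * (s ^ (b - 1) * M s)))
      (Ioc 0 t) := by
    refine Integrable.mono' ((i2.const_mul 2).add (i1.const_mul 2)) (hmeas.const_mul _) ?_
    filter_upwards [hpt, ae_restrict_mem measurableSet_Ioc] with s hs hs'
    rw [Real.norm_of_nonneg]
    · exact hs
    · have := hM0 s hs'.1
      have := Real.rpow_nonneg (sub_nonneg.2 hs'.2) (a - 1)
      have := hs'.1
      positivity
  have htb : t ^ (1 - b) ≠ 0 := by positivity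
  refine ⟨?_, i3, ?_⟩
  · have := hint.const_mul (t ^ (1 - b))⁻¹
    refine this.congr (ae_of_all _ fun s => ?_)
    simp only
    field_simp
  · rw [fracInt, intervalIntegral.integral_of_le ht.le, ← integral_const_mul]
    calc _ ≤ ∫ s in Ioc 0 t, 2 * ((t - s) ^ (a - 1) * M s) + 2 * (s ^ (a - 1) * M s) :=
          integral_mono_ae hint ((i2.const_mul 2).add (i1.const_mul 2)) hpt
      _ = 2 * (∫ s in Ioc 0 t, (t - s) ^ (a - 1) * M s) +
          2 * ∫ s in Ioc 0 t, s ^ (a - 1) * M s := by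
          rw [integral_add (i2.const_mul 2) (i1.const_mul 2), integral_const_mul,
            integral_const_mul]
      _ ≤ _ := by linarith

/-- The difference equals `u ^ (β - 1) * v ^ (β - 1)` times that of the powers `1 - β`, and those
powers are subadditive. -/
lemma rpow_sub_rpow_le {β c u v : ℝ} (hβ : 0 < β) (hβ1 : β < 1) (hc : 0 < c) (hcu : c ≤ u)
    (huv : u ≤ v) :
    |v ^ (β - 1) - u ^ (β - 1)| ≤ c ^ (2 * (β - 1)) * (v - u) ^ (1 - β) := by
  have hu : 0 < u := hc.trans_le hcu
  have hv : 0 < v := hu.trans_le huv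
  have h1 : v ^ (β - 1) ≤ u ^ (β - 1) := Real.rpow_le_rpow_of_nonpos hu huv (by linarith)
  rw [abs_sub_comm, abs_of_nonneg (by linarith)]
  have hsub : v ^ (1 - β) - u ^ (1 - β) ≤ (v - u) ^ (1 - β) := by
    have := Real.rpow_add_le_add_rpow hu.le (sub_nonneg.2 huv) (p := 1 - β)
      (by linarith) (by linarith)
    rw [add_sub_cancel] at this
    linarith
  have e : u ^ (β - 1) - v ^ (β - 1)
      = u ^ (β - 1) * v ^ (β - 1) * (v ^ (1 - β) - u ^ (1 - β)) := by
    have e1 : u ^ (β - 1) * u ^ (1 - β) = 1 := by rw [← Real.rpow_add hu]; simp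
    have e2 : v ^ (β - 1) * v ^ (1 - β) = 1 := by rw [← Real.rpow_add hv]; simp
    linear_combination (-u ^ (β - 1)) * e2 + v ^ (β - 1) * e1
  have h2 : u ^ (β - 1) * v ^ (β - 1) ≤ c ^ (2 * (β - 1)) := by
    rw [two_mul, Real.rpow_add hc]
    have a1 := Real.rpow_le_rpow_of_nonpos hc hcu (by linarith : β - 1 ≤ 0)
    have a2 := Real.rpow_le_rpow_of_nonpos hc (hcu.trans huv) (by linarith : β - 1 ≤ 0)
    gcongr
  rw [e]
  have := sub_nonneg.2 (Real.rpow_le_rpow hu.le huv (by linarith : 0 ≤ 1 - β))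
  gcongr

/-- On `(0, a / 2]` the kernel is Hölder in `t` and only the `L^1` norm of `h` matters; on the rest
`h` is bounded and the kernel is integrated explicitly. The estimate sees `h` only through `I` and
`W`, so it is uniform over dominated families. -/
lemma fracInt_modulus {β a b I W : ℝ} (hβ : 0 < β) (hβ1 : β < 1) (ha : 0 < a)
    {h : ℝ → ℝ} (hi : IntegrableOn h (Ioc 0 b)) (hI : ∫ s in Ioc 0 b, |h s| ≤ I)
    (hW : ∀ s ∈ Icc (a / 2) b, |h s| ≤ W) {t₀ t : ℝ} (hat : a ≤ t₀) (htt : t₀ ≤ t) (htb : t ≤ b) :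
    |fracInt β h t - fracInt β h t₀| ≤
      (a / 2) ^ (2 * (β - 1)) * I * |t - t₀| ^ (1 - β) + 2 * W / β * |t - t₀| ^ β := by
  set c := a / 2 with hcdef
  have hc : 0 < c := by positivity
  have hca : c + c = a := by rw [hcdef]; ring
  have hr : -1 < β - 1 := by linarith
  have hW0 : 0 ≤ W := (abs_nonneg _).trans (hW c ⟨le_rfl, by linarith⟩)
  have hii : IntervalIntegrable h volume 0 b :=
    (intervalIntegrable_iff_integrableOn_Ioc_of_le (by linarith)).2 hi
  have hhi : ∀ u v, 0 ≤ u → u ≤ v → v ≤ b → IntervalIntegrable h volume u v := fun u v hu huv hv =>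
    hii.mono_set (by rw [uIcc_of_le huv, uIcc_of_le (by linarith)]; exact Icc_subset_Icc hu hv)
  have hleft : ∀ r, a ≤ r → IntervalIntegrable (fun s => (r - s) ^ (β - 1) * h s) volume 0 c := by
    intro r hr
    refine (hhi 0 c le_rfl hc.le (by linarith)).continuousOn_mul ?_
    intro s hs
    rw [uIcc_of_le hc.le] at hs
    have : r - s ≠ 0 := by linarith [hs.2]
    exact (ContinuousAt.rpow_const (by fun_prop) (Or.inl this)).continuousWithinAt
  have hright : ∀ r u v, c ≤ u → u ≤ v → v ≤ b →
      IntervalIntegrable (fun s => (r - s) ^ (β - 1) * h s) volume u v := by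
    intro r u v hu huv hv
    refine (((intervalIntegrable_sub_rpow hr r u v).norm.mul_const W).mono_fun'
      (((Measurable.aestronglyMeasurable (by fun_prop))).mul ?_) ?_)
    · rw [uIoc_of_le huv]
      exact ((hhi u v (by linarith) huv hv).1).aestronglyMeasurable
    · rw [uIoc_of_le huv]
      refine (ae_restrict_iff' measurableSet_Ioc).2 (ae_of_all _ fun s hs => ?_)
      simp only [norm_mul]
      exact mul_le_mul_of_nonneg_left (hW s ⟨by linarith [hs.1], by linarith [hs.2]⟩)
        (norm_nonneg _)
  have e1 : fracInt β h t = (∫ s in (0 : ℝ)..c, (t - s) ^ (β - 1) * h s)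
      + (∫ s in c..t₀, (t - s) ^ (β - 1) * h s) + ∫ s in t₀..t, (t - s) ^ (β - 1) * h s := by
    rw [fracInt, add_assoc, intervalIntegral.integral_add_adjacent_intervals
      (hright t c t₀ le_rfl (by linarith) (by linarith)) (hright t t₀ t (by linarith) htt htb),
      intervalIntegral.integral_add_adjacent_intervals (hleft t (by linarith))
      (hright t c t le_rfl (by linarith) htb)]
  have e2 : fracInt β h t₀ = (∫ s in (0 : ℝ)..c, (t₀ - s) ^ (β - 1) * h s)
      + ∫ s in c..t₀, (t₀ - s) ^ (β - 1) * h s := by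
    rw [fracInt, intervalIntegral.integral_add_adjacent_intervals (hleft t₀ hat)
      (hright t₀ c t₀ le_rfl (by linarith) (by linarith))]
  have b1 : |(∫ s in (0 : ℝ)..c, (t - s) ^ (β - 1) * h s)
      - ∫ s in (0 : ℝ)..c, (t₀ - s) ^ (β - 1) * h s| ≤
      c ^ (2 * (β - 1)) * I * (t - t₀) ^ (1 - β) := by
    rw [← intervalIntegral.integral_sub (hleft t (by linarith)) (hleft t₀ hat)]
    have hn := (hhi 0 c le_rfl hc.le (by linarith)).abs.const_mul
      (c ^ (2 * (β - 1)) * (t - t₀) ^ (1 - β))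
    rw [← Real.norm_eq_abs]
    refine (intervalIntegral.norm_integral_le_of_norm_le hc.le (ae_of_all _ fun s hs => ?_)
      hn).trans ?_
    · rw [← sub_mul, norm_mul]
      gcongr
      · have := rpow_sub_rpow_le hβ hβ1 hc (u := t₀ - s) (v := t - s) (by linarith [hs.2])
          (by linarith)
        rwa [show t - s - (t₀ - s) = t - t₀ by ring] at this
      · exact le_rfl
    · rw [intervalIntegral.integral_const_mul, intervalIntegral.integral_of_le hc.le]
      have : ∫ s in Ioc 0 c, |h s| ≤ I := by
        refine le_trans (setIntegral_mono_set hi.abs (ae_of_all _ fun _ => abs_nonneg _)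
          (Ioc_subset_Ioc_right (by linarith)).eventuallyLE) hI
      have h0 : 0 ≤ c ^ (2 * (β - 1)) * (t - t₀) ^ (1 - β) := by
        have := sub_nonneg.2 htt
        positivity
      calc _ ≤ c ^ (2 * (β - 1)) * (t - t₀) ^ (1 - β) * I := by gcongr
        _ = _ := by ring
  have hne : ∀ᵐ s : ℝ ∂volume, s ≠ t₀ := by simp [ae_iff, measure_singleton]
  -- The kernel decreases in its base, so the difference has one sign and its absolute value
  -- integrates in closed form.
  have b2 : |(∫ s in c..t₀, (t - s) ^ (β - 1) * h s)
      - ∫ s in c..t₀, (t₀ - s) ^ (β - 1) * h s| ≤ W / β * (t - t₀) ^ β := by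
    have i1 := intervalIntegrable_sub_rpow hr t₀ c t₀
    have i2 := intervalIntegrable_sub_rpow hr t c t₀
    rw [← intervalIntegral.integral_sub (hright t c t₀ le_rfl (by linarith) (by linarith))
      (hright t₀ c t₀ le_rfl (by linarith) (by linarith))]
    rw [← Real.norm_eq_abs]
    refine (intervalIntegral.norm_integral_le_of_norm_le (by linarith : c ≤ t₀) ?_
      ((i1.sub i2).mul_const W)).trans ?_
    · filter_upwards [hne] with s hs hs'
      have hlt : 0 < t₀ - s := sub_pos.2 (lt_of_le_of_ne hs'.2 hs)
      have := Real.rpow_le_rpow_of_nonpos hlt (by linarith : t₀ - s ≤ t - s)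
        (by linarith : β - 1 ≤ 0)
      rw [← sub_mul, norm_mul, norm_sub_rev, Real.norm_of_nonneg (sub_nonneg.2 this)]
      exact mul_le_mul_of_nonneg_left (hW s ⟨hs'.1.le, by linarith [hs'.2]⟩) (sub_nonneg.2 this)
    · rw [intervalIntegral.integral_mul_const, intervalIntegral.integral_sub i1 i2,
        integral_sub_rpow hr, integral_sub_rpow hr, sub_self, sub_add_cancel,
        Real.zero_rpow hβ.ne']
      have := Real.rpow_le_rpow (by linarith : 0 ≤ t₀ - c) (by linarith : t₀ - c ≤ t - c) hβ.le
      rw [← sub_div, div_mul_eq_mul_div, div_mul_eq_mul_div]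
      refine div_le_div_of_nonneg_right ?_ hβ.le
      nlinarith
  have b3 : |∫ s in t₀..t, (t - s) ^ (β - 1) * h s| ≤ W / β * (t - t₀) ^ β := by
    rw [← Real.norm_eq_abs]
    refine (intervalIntegral.norm_integral_le_of_norm_le htt (ae_of_all _ fun s hs => ?_)
      ((intervalIntegrable_sub_rpow hr t t₀ t).mul_const W)).trans ?_
    · rw [norm_mul, Real.norm_of_nonneg (Real.rpow_nonneg (sub_nonneg.2 hs.2) _)]
      exact mul_le_mul_of_nonneg_left (hW s ⟨by linarith [hs.1], by linarith [hs.2]⟩)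
        (Real.rpow_nonneg (sub_nonneg.2 hs.2) _)
    · rw [intervalIntegral.integral_mul_const, integral_sub_rpow hr, sub_self, sub_add_cancel,
        Real.zero_rpow hβ.ne', sub_zero]
      exact le_of_eq (by ring)
  rw [abs_of_nonneg (sub_nonneg.2 htt), e1, e2]
  rw [abs_le] at *
  constructor <;> ring_nf at b1 b2 b3 ⊢ <;> linarith [b1.1, b1.2, b2.1, b2.2, b3.1, b3.2]

/-! ### Admissible weights and uniform moduli of continuity. -/

/-- A continuous weight on `(0, ∞)` which is locally integrable up to `0` and whose fractional
integral of some order `a < β` is `O(t ^ (β - 1 + θ))` at `0`. -/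
structure AdmissibleWeight (β a θ : ℝ) (w : ℝ → ℝ) : Prop where
  order_pos : 0 < a
  order_lt : a < β
  lt_one : β < 1
  exponent_pos : 0 < θ
  nonneg : ∀ s, 0 < s → 0 ≤ w s
  continuousOn : ContinuousOn w (Ioi 0)
  integrableOn : ∀ T, 0 < T → IntegrableOn w (Ioc 0 T)
  kernel_integrableOn : ∀ t, 0 < t → IntegrableOn (fun s => (t - s) ^ (a - 1) * w s) (Ioc 0 t)
  bound : ∀ T, 0 < T → ∃ C, 0 ≤ C ∧ ∀ t, 0 < t → t ≤ T →
    t ^ (1 - β) * fracInt a w t ≤ C * t ^ θ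

namespace AdmissibleWeight

variable {β a θ : ℝ} {w : ℝ → ℝ}

lemma pos (hw : AdmissibleWeight β a θ w) : 0 < β := hw.order_pos.trans hw.order_lt

lemma fracKernel_le (hw : AdmissibleWeight β a θ w) {s t : ℝ} (hst : s ≤ t) (hs : 0 ≤ s) :
    (t - s) ^ (β - 1) ≤ t ^ (β - a) * (t - s) ^ (a - 1) := by
  have h1 := hw.order_lt
  have h2 := hw.lt_one
  -- At `s = t` both sides vanish, because `0` to a nonzero power is `0` by convention.
  rcases eq_or_lt_of_le hst with rfl | h
  · rw [sub_self, Real.zero_rpow (by linarith), Real.zero_rpow (by linarith), mul_zero]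
  · have h0 : 0 < t - s := sub_pos.2 h
    calc (t - s) ^ (β - 1) = (t - s) ^ (β - a) * (t - s) ^ (a - 1) := by
          rw [← Real.rpow_add h0]; ring_nf
      _ ≤ _ := by
          gcongr
          · linarith

lemma kernel_mul_integrableOn (hw : AdmissibleWeight β a θ w) {t B : ℝ} (ht : 0 < t) {h : ℝ → ℝ}
    (hc : ContinuousOn h (Ioi 0)) (hB : ∀ s ∈ Ioc 0 t, |h s| ≤ B * w s) :
    IntegrableOn (fun s => (t - s) ^ (β - 1) * h s) (Ioc 0 t) := by
  refine Integrable.mono' (((hw.kernel_integrableOn t ht).const_mul (t ^ (β - a))).const_mul B)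
    (AEStronglyMeasurable.mul (Measurable.aestronglyMeasurable (by fun_prop))
      ((hc.mono Ioc_subset_Ioi_self).aestronglyMeasurable measurableSet_Ioc)) ?_
  refine (ae_restrict_iff' measurableSet_Ioc).2 (ae_of_all _ fun s hs => ?_)
  have h0 := Real.rpow_nonneg (sub_nonneg.2 hs.2) (β - 1)
  rw [norm_mul, Real.norm_of_nonneg h0]
  calc (t - s) ^ (β - 1) * ‖h s‖ ≤ (t - s) ^ (β - 1) * (B * w s) :=
        mul_le_mul_of_nonneg_left (hB s hs) h0
    _ ≤ t ^ (β - a) * (t - s) ^ (a - 1) * (B * w s) :=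
        mul_le_mul_of_nonneg_right (hw.fracKernel_le hs.2 hs.1.le)
          ((abs_nonneg _).trans (hB s hs))
    _ = _ := by ring

lemma kernel_mul_intervalIntegrable (hw : AdmissibleWeight β a θ w) {t B : ℝ} (ht : 0 < t)
    {h : ℝ → ℝ} (hc : ContinuousOn h (Ioi 0)) (hB : ∀ s ∈ Ioc 0 t, |h s| ≤ B * w s) :
    IntervalIntegrable (fun s => (t - s) ^ (β - 1) * h s) volume 0 t :=
  (intervalIntegrable_iff_integrableOn_Ioc_of_le ht.le).2 (hw.kernel_mul_integrableOn ht hc hB)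

lemma abs_fracInt_le (hw : AdmissibleWeight β a θ w) {t B : ℝ} (ht : 0 < t)
    {h : ℝ → ℝ} (hB : ∀ s ∈ Ioc 0 t, |h s| ≤ B * w s) :
    |fracInt β h t| ≤ B * (t ^ (β - a) * fracInt a w t) := by
  have hi := (intervalIntegrable_iff_integrableOn_Ioc_of_le ht.le).2 (hw.kernel_integrableOn t ht)
  rw [← Real.norm_eq_abs]
  refine (intervalIntegral.norm_integral_le_of_norm_le ht.le (ae_of_all _ fun s hs => ?_)
    ((hi.const_mul (t ^ (β - a))).const_mul B)).trans ?_
  · have h0 := Real.rpow_nonneg (sub_nonneg.2 hs.2) (β - 1)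
    rw [norm_mul, Real.norm_of_nonneg h0]
    calc (t - s) ^ (β - 1) * ‖h s‖ ≤ (t - s) ^ (β - 1) * (B * w s) :=
          mul_le_mul_of_nonneg_left (hB s hs) h0
      _ ≤ t ^ (β - a) * (t - s) ^ (a - 1) * (B * w s) :=
          mul_le_mul_of_nonneg_right (hw.fracKernel_le hs.2 hs.1.le)
            ((abs_nonneg _).trans (hB s hs))
      _ = _ := by ring
  · rw [intervalIntegral.integral_const_mul, intervalIntegral.integral_const_mul, fracInt]

lemma weighted_abs_fracInt_le (hw : AdmissibleWeight β a θ w) {T : ℝ} (hT : 0 < T) :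
    ∃ C, 0 ≤ C ∧ ∀ (B t : ℝ), 0 ≤ B → 0 < t → t ≤ T → ∀ h : ℝ → ℝ,
      (∀ s ∈ Ioc 0 t, |h s| ≤ B * w s) → t ^ (1 - β) * |fracInt β h t| ≤ B * C * t ^ θ := by
  obtain ⟨C, hC, hb⟩ := hw.bound T hT
  have h1 := hw.order_lt
  refine ⟨T ^ (β - a) * C, by positivity, fun B t hB0 ht htT h hB => ?_⟩
  have h2 := hb t ht htT
  have h3 := hw.abs_fracInt_le ht hB
  calc t ^ (1 - β) * |fracInt β h t| ≤ t ^ (1 - β) * (B * (t ^ (β - a) * fracInt a w t)) := by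
        gcongr
    _ = B * t ^ (β - a) * (t ^ (1 - β) * fracInt a w t) := by ring
    _ ≤ B * t ^ (β - a) * (C * t ^ θ) := by gcongr
    _ ≤ B * T ^ (β - a) * (C * t ^ θ) := by
        gcongr
    _ = _ := by ring

/-- Uniform modulus of continuity of `t ^ (1 - β) * fracInt β h t` over all `h` dominated by a
multiple of the weight. -/
lemma exists_modulus (hw : AdmissibleWeight β a θ w) {t₀ B : ℝ} (ht₀ : 0 ≤ t₀) (hB : 0 ≤ B) :
    ∃ ω : ℝ → ℝ, Tendsto ω (𝓝 t₀) (𝓝 0) ∧ ∀ᶠ t in 𝓝 t₀, 0 ≤ t → ∀ h : ℝ → ℝ,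
      ContinuousOn h (Ioi 0) → (∀ s ∈ Ioc 0 (t₀ + 1), |h s| ≤ B * w s) →
      |t ^ (1 - β) * fracInt β h t - t₀ ^ (1 - β) * fracInt β h t₀| ≤ ω t := by
  have hβ := hw.pos
  have hβ1 := hw.lt_one
  obtain ⟨C, hC, hb⟩ := hw.weighted_abs_fracInt_le (T := t₀ + 1) (by linarith)
  -- At `0` the modulus is the bound `t ^ θ`; away from `0` it comes from `fracInt_modulus`.
  rcases ht₀.eq_or_lt with rfl | hpos
  · refine ⟨fun t => B * C * t ^ θ, ?_, ?_⟩
    · have : ContinuousAt (fun t : ℝ => B * C * t ^ θ) 0 :=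
        continuousAt_const.mul (Real.continuousAt_rpow_const _ _ (Or.inr hw.exponent_pos.le))
      simpa [Real.zero_rpow hw.exponent_pos.ne', ContinuousAt] using this
    · filter_upwards [Iio_mem_nhds (show (0 : ℝ) < 0 + 1 by norm_num)] with t ht1 ht0 h hc hh
      rw [Real.zero_rpow (by linarith : 1 - β ≠ 0), zero_mul, sub_zero]
      rcases ht0.eq_or_lt with rfl | ht
      · rw [Real.zero_rpow (by linarith : 1 - β ≠ 0), zero_mul, abs_zero]
        positivity
      · rw [abs_mul, abs_of_nonneg (by positivity)]
        exact hb B t hB ht ht1.le h fun s hs => hh s ⟨hs.1, hs.2.trans ht1.le⟩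
  -- For `t < t₀` the roles of the two points are exchanged, so `fracInt_modulus` is used with lower
  -- endpoint `t₀ / 2`, and it halves this once more.
  · obtain ⟨W, hW⟩ := (isCompact_Icc (a := t₀ / 2 / 2) (b := t₀ + 1)).exists_bound_of_continuousOn
      (f := w) (hw.continuousOn.mono fun s hs => lt_of_lt_of_le (by positivity) hs.1)
    set I := ∫ s in Ioc 0 (t₀ + 1), B * w s with hI
    set D := (t₀ / 2 / 2) ^ (2 * (β - 1)) * I
    set E := 2 * (B * W) / β
    refine ⟨fun t => |t ^ (1 - β) - t₀ ^ (1 - β)| * (t₀ ^ (β - 1) * (B * C * t₀ ^ θ)) +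
      t ^ (1 - β) * (D * |t - t₀| ^ (1 - β) + E * |t - t₀| ^ β), ?_, ?_⟩
    · have h1 : ContinuousAt (fun t : ℝ => t ^ (1 - β)) t₀ :=
        Real.continuousAt_rpow_const _ _ (Or.inl hpos.ne')
      have h2 : ∀ r : ℝ, 0 < r → ContinuousAt (fun t : ℝ => |t - t₀| ^ r) t₀ := fun r hr =>
        ContinuousAt.rpow_const (by fun_prop) (Or.inr hr.le)
      have h3 : ContinuousAt (fun t =>
          |t ^ (1 - β) - t₀ ^ (1 - β)| * (t₀ ^ (β - 1) * (B * C * t₀ ^ θ)) +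
          t ^ (1 - β) * (D * |t - t₀| ^ (1 - β) + E * |t - t₀| ^ β)) t₀ :=
        (((h1.sub continuousAt_const).abs).mul continuousAt_const).add
          (h1.mul ((continuousAt_const.mul (h2 _ (by linarith))).add
            (continuousAt_const.mul (h2 _ hβ))))
      have h4 := h3.tendsto
      simpa [Real.zero_rpow hβ.ne', Real.zero_rpow (by linarith : 1 - β ≠ 0)] using h4
    · filter_upwards [Iio_mem_nhds (show t₀ < t₀ + 1 by linarith),
        Ioi_mem_nhds (show t₀ / 2 < t₀ by linarith)] with t ht1 ht2 ht0 h hc hh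
      have ht : 0 < t := lt_trans (by positivity) ht2
      have hhi : IntegrableOn h (Ioc 0 (t₀ + 1)) := by
        refine Integrable.mono' ((hw.integrableOn (t₀ + 1) (by linarith)).const_mul B)
          ((hc.mono Ioc_subset_Ioi_self).aestronglyMeasurable measurableSet_Ioc) ?_
        exact (ae_restrict_iff' measurableSet_Ioc).2 (ae_of_all _ hh)
      have hhI : ∫ s in Ioc 0 (t₀ + 1), |h s| ≤ I :=
        setIntegral_mono_on hhi.abs ((hw.integrableOn (t₀ + 1) (by linarith)).const_mul B)
          measurableSet_Ioc hh
      have hhW : ∀ s ∈ Icc (t₀ / 2 / 2) (t₀ + 1), |h s| ≤ B * W := fun s hs => by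
        have hs0 : 0 < s := lt_of_lt_of_le (by positivity) hs.1
        exact (hh s ⟨hs0, hs.2⟩).trans
          (mul_le_mul_of_nonneg_left ((le_abs_self _).trans (hW s hs)) hB)
      have hV : |fracInt β h t - fracInt β h t₀| ≤
          D * |t - t₀| ^ (1 - β) + E * |t - t₀| ^ β := by
        rcases le_total t₀ t with h1 | h1
        · exact fracInt_modulus hβ hβ1 (by positivity) hhi hhI hhW (by linarith) h1 ht1.le
        · rw [abs_sub_comm, abs_sub_comm t]
          exact fracInt_modulus hβ hβ1 (by positivity) hhi hhI hhW ht2.le h1 (by linarith)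
      have hK : |fracInt β h t₀| ≤ t₀ ^ (β - 1) * (B * C * t₀ ^ θ) := by
        have := hb B t₀ hB hpos (by linarith) h fun s hs => hh s ⟨hs.1, by linarith [hs.2]⟩
        calc |fracInt β h t₀| = t₀ ^ (β - 1) * (t₀ ^ (1 - β) * |fracInt β h t₀|) := by
              rw [← mul_assoc, ← Real.rpow_add hpos]; simp
          _ ≤ _ := by gcongr
      calc _ = |(t ^ (1 - β) - t₀ ^ (1 - β)) * fracInt β h t₀ +
            t ^ (1 - β) * (fracInt β h t - fracInt β h t₀)| := by ring_nf
        _ ≤ |t ^ (1 - β) - t₀ ^ (1 - β)| * |fracInt β h t₀| +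
            t ^ (1 - β) * |fracInt β h t - fracInt β h t₀| := by
            refine (abs_add_le _ _).trans ?_
            rw [abs_mul, abs_mul, abs_of_nonneg (Real.rpow_nonneg ht0 (1 - β))]
        _ ≤ _ := by gcongr

end AdmissibleWeight

/-! ### The delayed equation, solved by the method of steps. -/

/-- The right-hand side of the weighted Volterra equation, with the unknown function delayed
by `δ`. -/
noncomputable def delayOp (β κ x₀ : ℝ) (g : ℝ → ℝ → ℝ) (δ : ℝ) (y : ℝ → ℝ) (t : ℝ) : ℝ :=
  x₀ + κ * ((max t 0) ^ (1 - β) * fracInt β (fun s => g s (y (s - δ))) (max t 0))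

lemma continuousOn_delayed {g : ℝ → ℝ → ℝ}
    (hg : ContinuousOn (fun q : ℝ × ℝ => g q.1 q.2) (Ioi 0 ×ˢ univ)) {y : ℝ → ℝ}
    (hy : Continuous y) (δ : ℝ) : ContinuousOn (fun s => g s (y (s - δ))) (Ioi 0) :=
  hg.comp (f := fun s : ℝ => (s, y (s - δ)))
    (by fun_prop : Continuous fun s : ℝ => (s, y (s - δ))).continuousOn
    fun _ hs => ⟨hs, mem_univ _⟩

/-- Values up to `τ` determine the image up to `τ + δ`: this gain of `δ` drives the method of steps.
Clamping by `max t 0` makes the image constant on `t ≤ 0`. -/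
lemma delayOp_congr {β κ x₀ : ℝ} {g : ℝ → ℝ → ℝ} {δ τ : ℝ} {y z : ℝ → ℝ}
    (h : ∀ s ≤ τ, y s = z s) {t : ℝ} (ht : t ≤ τ + δ) (hτ : 0 ≤ τ + δ) :
    delayOp β κ x₀ g δ y t = delayOp β κ x₀ g δ z t := by
  have hm : max t 0 ≤ τ + δ := max_le ht hτ
  have : fracInt β (fun s => g s (y (s - δ))) (max t 0) =
      fracInt β (fun s => g s (z (s - δ))) (max t 0) := by
    refine intervalIntegral.integral_congr fun s hs => ?_
    rw [uIcc_of_le (le_max_right _ _)] at hs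
    simp only [h (s - δ) (by linarith [hs.2])]
  rw [delayOp, delayOp, this]

lemma rpow_le_exp {x r : ℝ} (hx : 0 ≤ x) (hr0 : 0 ≤ r) (hr : r ≤ 1) : x ^ r ≤ Real.exp x := by
  calc x ^ r ≤ (Real.exp x) ^ r :=
        Real.rpow_le_rpow hx (by linarith [Real.add_one_le_exp x]) hr0
    _ = Real.exp (x * r) := (Real.exp_mul x r).symm
    _ ≤ Real.exp x := Real.exp_le_exp.2 (by nlinarith)

namespace AdmissibleWeight

variable {β a θ : ℝ} {w : ℝ → ℝ}

/-- Apply `u ^ r ≤ exp u` to `u = c * (t - s)`, `r = β - a`. Lowering the order from `β` to `a`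
gains the factor `c ^ (-(β - a))`, small for large `c`. -/
lemma fracKernel_mul_exp_le (hw : AdmissibleWeight β a θ w) {s t c : ℝ} (hst : s ≤ t)
    (hc : 0 < c) : (t - s) ^ (β - 1) * Real.exp (c * s) ≤
      c ^ (-(β - a)) * Real.exp (c * t) * (t - s) ^ (a - 1) := by
  have h1 := hw.order_lt
  have h2 := hw.lt_one
  have h3 := hw.order_pos
  rcases eq_or_lt_of_le hst with rfl | h
  · rw [sub_self, Real.zero_rpow (by linarith), Real.zero_rpow (by linarith), zero_mul, mul_zero]
  · have h0 : 0 < t - s := sub_pos.2 h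
    have e1 : Real.exp (c * t) = Real.exp (c * s) * Real.exp (c * (t - s)) := by
      rw [← Real.exp_add]; ring_nf
    have e2 := rpow_le_exp (x := c * (t - s)) (r := β - a) (by positivity) (by linarith)
      (by linarith)
    have e3 : (t - s) ^ (β - 1) = c ^ (-(β - a)) * (c * (t - s)) ^ (β - a) * (t - s) ^ (a - 1) := by
      rw [Real.mul_rpow hc.le h0.le, ← mul_assoc, ← Real.rpow_add hc, neg_add_cancel,
        Real.rpow_zero, one_mul, ← Real.rpow_add h0]
      ring_nf
    rw [e1, e3]
    calc _ = c ^ (-(β - a)) * (Real.exp (c * s) * (c * (t - s)) ^ (β - a)) * (t - s) ^ (a - 1) := by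
          ring
      _ ≤ _ := by gcongr

/-- A bound of exponential type which is preserved by all the delayed operators. -/
lemma exists_invariant_bound (hw : AdmissibleWeight β a θ w) {κ : ℝ} (hκ : 0 ≤ κ) (x₀ : ℝ)
    {g : ℝ → ℝ → ℝ} (hgw : ∀ s, 0 < s → ∀ y, |g s y| ≤ w s * (1 + |y|)) {T : ℝ} (hT : 0 < T) :
    ∃ C c : ℝ, |x₀| ≤ C ∧ 0 < c ∧ ∀ δ, 0 ≤ δ → ∀ y : ℝ → ℝ,
      (∀ t ≤ T, |y t| ≤ C * Real.exp (c * max t 0)) →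
      ∀ t ≤ T, |delayOp β κ x₀ g δ y t| ≤ C * Real.exp (c * max t 0) := by
  obtain ⟨D, hD, hb⟩ := hw.bound T hT
  have hlt := hw.order_lt
  have hβ1 := hw.lt_one
  -- The rate `c` is chosen so large that the integral term takes at most half of the bound, as in a
  -- Bielecki norm.
  have hlim : Tendsto (fun c : ℝ => c ^ (-(β - a)) * (2 * κ * D * T ^ θ)) atTop (𝓝 0) := by
    simpa using (tendsto_rpow_neg_atTop (sub_pos.2 hlt)).mul_const (2 * κ * D * T ^ θ)
  obtain ⟨c, hc, hc0⟩ := ((hlim.eventually (gt_mem_nhds (by norm_num : (0 : ℝ) < 1 / 2))).and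
    (eventually_gt_atTop 0)).exists
  -- The other half of `C` absorbs `|x₀|`, and `C ≥ 1` absorbs the `1` in `1 + |y|`.
  refine ⟨2 * |x₀| + 1, c, by linarith [abs_nonneg x₀], hc0, fun δ hδ y hy t ht => ?_⟩
  set C := 2 * |x₀| + 1 with hC
  have hC1 : 1 ≤ C := by linarith [abs_nonneg x₀]
  rcases le_or_gt t 0 with h0 | h0
  · rw [delayOp, max_eq_right h0, Real.zero_rpow (by linarith : 1 - β ≠ 0)]
    simp
    linarith [abs_nonneg x₀]
  rw [delayOp, max_eq_left h0.le]
  have hdom : ∀ s ∈ Ioc 0 t, |g s (y (s - δ))| ≤ 2 * C * Real.exp (c * s) * w s := fun s hs => by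
    have h1 := hgw s hs.1 (y (s - δ))
    have h2 := hy (s - δ) (by linarith [hs.2])
    have h3 : Real.exp (c * max (s - δ) 0) ≤ Real.exp (c * s) := by
      have : max (s - δ) 0 ≤ s := max_le (by linarith) hs.1.le
      gcongr
    have h4 : 1 ≤ Real.exp (c * s) := Real.one_le_exp (mul_nonneg hc0.le hs.1.le)
    have h5 := hw.nonneg s hs.1
    have h6 : 1 + |y (s - δ)| ≤ 2 * C * Real.exp (c * s) := by nlinarith
    nlinarith
  have hi := (intervalIntegrable_iff_integrableOn_Ioc_of_le h0.le).2
    (hw.kernel_integrableOn t h0)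
  have hV : |fracInt β (fun s => g s (y (s - δ))) t| ≤
      2 * C * (c ^ (-(β - a)) * Real.exp (c * t)) * fracInt a w t := by
    rw [fracInt, ← Real.norm_eq_abs]
    refine (intervalIntegral.norm_integral_le_of_norm_le h0.le (ae_of_all _ fun s hs => ?_)
      (hi.const_mul (2 * C * (c ^ (-(β - a)) * Real.exp (c * t))))).trans ?_
    · have hk := Real.rpow_nonneg (sub_nonneg.2 hs.2) (β - 1)
      rw [norm_mul, Real.norm_of_nonneg hk]
      calc (t - s) ^ (β - 1) * ‖g s (y (s - δ))‖
          ≤ (t - s) ^ (β - 1) * (2 * C * Real.exp (c * s) * w s) :=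
            mul_le_mul_of_nonneg_left (hdom s hs) hk
        _ = 2 * C * w s * ((t - s) ^ (β - 1) * Real.exp (c * s)) := by ring
        _ ≤ 2 * C * w s * (c ^ (-(β - a)) * Real.exp (c * t) * (t - s) ^ (a - 1)) := by
            have := hw.nonneg s hs.1
            exact mul_le_mul_of_nonneg_left (hw.fracKernel_mul_exp_le hs.2 hc0) (by positivity)
        _ = _ := by ring
    · rw [intervalIntegral.integral_const_mul, fracInt]
  have hbt := hb t h0 ht
  have hmain : κ * (t ^ (1 - β) * |fracInt β (fun s => g s (y (s - δ))) t|) ≤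
      1 / 2 * (C * Real.exp (c * t)) := by
    calc _ ≤ κ * (t ^ (1 - β) *
          (2 * C * (c ^ (-(β - a)) * Real.exp (c * t)) * fracInt a w t)) := by gcongr
      _ = 2 * κ * C * Real.exp (c * t) * c ^ (-(β - a)) * (t ^ (1 - β) * fracInt a w t) := by ring
      _ ≤ 2 * κ * C * Real.exp (c * t) * c ^ (-(β - a)) * (D * t ^ θ) := by gcongr
      _ ≤ 2 * κ * C * Real.exp (c * t) * c ^ (-(β - a)) * (D * T ^ θ) := by
          have := hw.exponent_pos
          gcongr
      _ = (c ^ (-(β - a)) * (2 * κ * D * T ^ θ)) * (C * Real.exp (c * t)) := by ring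
      _ ≤ _ := by gcongr
  have h1 : 1 ≤ Real.exp (c * t) := Real.one_le_exp (by positivity)
  refine (abs_add_le _ _).trans ?_
  rw [abs_mul, abs_mul, abs_of_nonneg hκ, abs_of_nonneg (Real.rpow_nonneg h0.le (1 - β))]
  nlinarith [abs_nonneg x₀]

/-- The modulus depends on `y` only through `R`, and not on `δ`: it gives both the continuity of
each iterate and the equicontinuity of the delayed solutions. -/
lemma delayOp_modulus (hw : AdmissibleWeight β a θ w) {κ : ℝ} (hκ : 0 ≤ κ) (x₀ : ℝ)
    {g : ℝ → ℝ → ℝ} (hg : ContinuousOn (fun q : ℝ × ℝ => g q.1 q.2) (Ioi 0 ×ˢ univ))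
    (hgw : ∀ s, 0 < s → ∀ y, |g s y| ≤ w s * (1 + |y|)) (t₀ : ℝ) {R : ℝ} (hR : 0 ≤ R) :
    ∃ ω : ℝ → ℝ, Tendsto ω (𝓝 t₀) (𝓝 0) ∧ ∀ᶠ t in 𝓝 t₀, ∀ δ, 0 ≤ δ → ∀ y : ℝ → ℝ,
      Continuous y → (∀ s ≤ max t₀ 0 + 1, |y s| ≤ R) →
      |delayOp β κ x₀ g δ y t - delayOp β κ x₀ g δ y t₀| ≤ ω t := by
  obtain ⟨ω, hω, he⟩ := hw.exists_modulus (le_max_right t₀ 0) (B := 1 + R) (by linarith)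
  have hm : Tendsto (fun t : ℝ => max t 0) (𝓝 t₀) (𝓝 (max t₀ 0)) :=
    (by fun_prop : Continuous fun t : ℝ => max t 0).tendsto t₀
  refine ⟨fun t => κ * ω (max t 0), by simpa using (hω.comp hm).const_mul κ, ?_⟩
  filter_upwards [hm.eventually he] with t ht δ hδ y hy hyR
  have := ht (le_max_right _ _) _ (continuousOn_delayed hg hy δ) fun s hs => by
    refine (hgw s hs.1 _).trans ?_
    rw [mul_comm]
    exact mul_le_mul_of_nonneg_right (by linarith [hyR (s - δ) (by linarith [hs.2])])
      (hw.nonneg s hs.1)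
  rw [delayOp, delayOp, add_sub_add_left_eq_sub, ← mul_sub, abs_mul, abs_of_nonneg hκ]
  gcongr

/-- Existence of solutions of the delayed equations, with bounds independent of the delay. -/
lemma exists_delayed_solution (hw : AdmissibleWeight β a θ w) {κ : ℝ} (hκ : 0 ≤ κ) (x₀ : ℝ)
    {g : ℝ → ℝ → ℝ} (hg : ContinuousOn (fun q : ℝ × ℝ => g q.1 q.2) (Ioi 0 ×ˢ univ))
    (hgw : ∀ s, 0 < s → ∀ y, |g s y| ≤ w s * (1 + |y|)) :
    ∃ R : ℝ → ℝ, ∀ δ, 0 < δ → ∃ y : ℝ → ℝ, Continuous y ∧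
      (∀ t, delayOp β κ x₀ g δ y t = y t) ∧ ∀ T, 0 < T → ∀ t ≤ T, |y t| ≤ R T := by
  choose! C c hC hc hinv using fun T (hT : 0 < T) => hw.exists_invariant_bound hκ x₀ hgw hT
  refine ⟨fun T => C T * Real.exp (c T * T), fun δ hδ => ?_⟩
  set Y : ℕ → ℝ → ℝ := fun j => (delayOp β κ x₀ g δ)^[j] (fun _ => x₀) with hY
  have hYs : ∀ j, Y (j + 1) = delayOp β κ x₀ g δ (Y j) := fun j =>
    Function.iterate_succ_apply' _ _ _
  have hC0 : ∀ T, 0 < T → 0 ≤ C T := fun T hT => (abs_nonneg _).trans (hC T hT)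
  have hYb : ∀ j T, 0 < T → ∀ t ≤ T, |Y j t| ≤ C T * Real.exp (c T * max t 0) := by
    intro j T hT
    induction j with
    | zero =>
      intro t ht
      have h1 : 1 ≤ Real.exp (c T * max t 0) :=
        Real.one_le_exp (mul_nonneg (hc T hT).le (le_max_right _ _))
      exact (hC T hT).trans (le_mul_of_one_le_right (hC0 T hT) h1)
    | succ j ih =>
      rw [hYs]
      exact hinv T hT δ hδ.le _ ih
  have hYR : ∀ j T, 0 < T → ∀ t ≤ T, |Y j t| ≤ C T * Real.exp (c T * T) := by
    intro j T hT t ht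
    refine (hYb j T hT t ht).trans ?_
    have := hC0 T hT
    have := (hc T hT).le
    have := max_le ht hT.le
    gcongr
  have hYc : ∀ j, Continuous (Y j) := by
    intro j
    induction j with
    | zero => exact continuous_const
    | succ j ih =>
      rw [hYs, continuous_iff_continuousAt]
      intro t₀
      have hT : 0 < max t₀ 0 + 1 := by positivity
      obtain ⟨ω, hω, he⟩ := hw.delayOp_modulus hκ x₀ hg hgw t₀
        (R := C (max t₀ 0 + 1) * Real.exp (c (max t₀ 0 + 1) * (max t₀ 0 + 1)))
        (mul_nonneg (hC0 _ hT) (Real.exp_pos _).le)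
      rw [ContinuousAt, tendsto_iff_norm_sub_tendsto_zero]
      refine squeeze_zero' (Eventually.of_forall fun _ => norm_nonneg _) ?_ hω
      filter_upwards [he] with t ht
      exact ht δ hδ.le _ ih (hYR j _ hT)
  -- Iterates stabilise: all equal `x₀` for `t ≤ 0`, and each further application extends the
  -- agreement by `δ`.
  have hstep : ∀ j : ℕ, ∀ t ≤ j * δ, Y j t = Y (j + 1) t := by
    intro j
    induction j with
    | zero =>
      intro t ht
      rw [hYs, delayOp, max_eq_right (by simpa using ht),
        Real.zero_rpow (by linarith [hw.lt_one] : 1 - β ≠ 0)]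
      simp [hY]
    | succ j ih =>
      intro t ht
      push_cast at ht
      rw [hYs j, hYs (j + 1)]
      exact delayOp_congr ih (by linarith) (by positivity)
  have hmono : ∀ i j : ℕ, i ≤ j → ∀ t ≤ i * δ, Y i t = Y j t := by
    intro i j hij
    induction j, hij using Nat.le_induction with
    | base => exact fun _ _ => rfl
    | succ j hij ih =>
      intro t ht
      rw [ih t ht]
      refine hstep j t (ht.trans ?_)
      have : (i : ℝ) ≤ j := by exact_mod_cast hij
      gcongr
  -- The iterate of index `⌈t / δ⌉₊` is already stationary at `t`; for `t ≤ 0` this is iterate `0`.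
  set y : ℝ → ℝ := fun t => Y ⌈t / δ⌉₊ t with hy
  have hyY : ∀ j : ℕ, ∀ t ≤ j * δ, y t = Y j t := by
    intro j t ht
    refine hmono _ j (Nat.ceil_le.2 ((div_le_iff₀ hδ).2 ht)) t ?_
    exact (div_le_iff₀ hδ).1 (Nat.le_ceil _)
  have hex : ∀ t, ∃ j : ℕ, t < j * δ := fun t => by
    obtain ⟨j, hj⟩ := exists_nat_gt (t / δ)
    exact ⟨j, (div_lt_iff₀ hδ).1 hj⟩
  refine ⟨y, ?_, ?_, fun T hT t ht => hYR _ T hT t ht⟩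
  · rw [continuous_iff_continuousAt]
    intro t
    obtain ⟨j, hj⟩ := hex t
    refine (hYc j).continuousAt.congr ?_
    filter_upwards [Iio_mem_nhds hj] with s hs using (hyY j s (le_of_lt hs)).symm
  · intro t
    obtain ⟨j, hj⟩ := hex t
    rw [delayOp_congr (hyY j) (by linarith) (by positivity), ← hYs, ← hstep j t hj.le,
      hyY j t hj.le]

end AdmissibleWeight

/-! ### Compactness and removal of the delay. -/

/-- Arzelà–Ascoli on the real line, in sequential form. -/
lemma exists_subseq_tendstoLocallyUniformly {F : ℕ → ℝ → ℝ} (hF : Equicontinuous F) {R : ℝ → ℝ}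
    (hR : ∀ n t, |F n t| ≤ R t) :
    ∃ (y : ℝ → ℝ) (φ : ℕ → ℕ), Continuous y ∧ StrictMono φ ∧
      TendstoLocallyUniformly (fun n => F (φ n)) y atTop := by
  have hr : (range F).Equicontinuous := equicontinuous_iff_range.1 hF
  have hcl : (closure (range F)).Equicontinuous := hr.closure
  set S : Set C(ℝ, ℝ) := {f | (f : ℝ → ℝ) ∈ closure (range F)} with hS
  -- Pointwise limits of an equicontinuous family are continuous, so no point of the closure is lost
  -- in `C(ℝ, ℝ)`.
  have himg : ContinuousMap.toFun '' S = closure (range F) := by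
    ext f
    constructor
    · rintro ⟨g, hg, rfl⟩
      exact hg
    · intro hf
      exact ⟨⟨f, hcl.continuous ⟨f, hf⟩⟩, hf, rfl⟩
  -- Tychonoff, from the pointwise bounds.
  have hcomp : IsCompact (closure (range F)) := by
    refine IsCompact.of_isClosed_subset (isCompact_univ_pi fun t => isCompact_Icc
      (a := -R t) (b := R t)) isClosed_closure (closure_minimal ?_ ?_)
    · rintro _ ⟨n, rfl⟩ t -
      exact abs_le.1 (hR n t)
    · exact isClosed_set_pi fun t _ => isClosed_Icc
  have hSc : IsCompact S := by
    refine ArzelaAscoli.isCompact_of_equicontinuous S (himg ▸ hcomp) ?_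
    exact hcl.comp (fun f : S => (⟨(f : C(ℝ, ℝ)), f.2⟩ : closure (range F)))
  obtain ⟨y, -, φ, hφ, hlim⟩ := hSc.tendsto_subseq
    (x := fun n => (⟨F n, hF.continuous n⟩ : C(ℝ, ℝ))) fun n => subset_closure ⟨n, rfl⟩
  exact ⟨y, φ, y.continuous, hφ, ContinuousMap.tendsto_iff_tendstoLocallyUniformly.1 hlim⟩

namespace AdmissibleWeight

variable {β a θ : ℝ} {w : ℝ → ℝ}

/-- Existence of a global solution of the weighted Volterra equation. -/
theorem exists_volterra_solution (hw : AdmissibleWeight β a θ w) {κ : ℝ} (hκ : 0 ≤ κ) (x₀ : ℝ)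
    {g : ℝ → ℝ → ℝ} (hg : ContinuousOn (fun q : ℝ × ℝ => g q.1 q.2) (Ioi 0 ×ˢ univ))
    (hgw : ∀ s, 0 < s → ∀ y, |g s y| ≤ w s * (1 + |y|)) :
    ∃ y : ℝ → ℝ, Continuous y ∧ ∀ t, 0 ≤ t →
      y t = x₀ + κ * (t ^ (1 - β) * fracInt β (fun s => g s (y s)) t) := by
  obtain ⟨R, hR⟩ := hw.exists_delayed_solution hκ x₀ hg hgw
  choose Y hYc hYe hYb using fun n : ℕ => hR (1 / ((n : ℝ) + 1)) (by positivity)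
  have hT : ∀ t : ℝ, 0 < max t 0 + 1 := fun t => by positivity
  have heq : Equicontinuous Y := by
    intro t₀
    obtain ⟨ω, hω, he⟩ := hw.delayOp_modulus hκ x₀ hg hgw t₀
      (R := R (max t₀ 0 + 1)) ((abs_nonneg _).trans (hYb 0 _ (hT t₀) _ le_rfl))
    refine Metric.equicontinuousAt_of_continuity_modulus ω hω Y ?_
    filter_upwards [he] with t ht n
    have := ht (1 / ((n : ℝ) + 1)) (by positivity) (Y n) (hYc n) (hYb n _ (hT t₀))
    rwa [hYe n, hYe n, ← Real.dist_eq, dist_comm] at this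
  obtain ⟨y, φ, hy, hφ, hlim⟩ := exists_subseq_tendstoLocallyUniformly heq
    (R := fun t => R (max t 0 + 1))
    fun n t => hYb n _ (hT t) t (by linarith [le_max_left t 0])
  refine ⟨y, hy, fun t ht => ?_⟩
  have hYt : Tendsto (fun n => Y (φ n) t) atTop (𝓝 (y t)) :=
    hlim.tendsto_comp hy.continuousAt tendsto_const_nhds
  refine tendsto_nhds_unique hYt ?_
  have hrw : ∀ n, Y (φ n) t = x₀ + κ * (t ^ (1 - β) *
      fracInt β (fun s => g s (Y (φ n) (s - 1 / ((φ n : ℝ) + 1)))) t) := fun n => by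
    conv_lhs => rw [← hYe (φ n), delayOp, max_eq_left ht]
  simp_rw [hrw]
  refine tendsto_const_nhds.add (Tendsto.const_mul _ (Tendsto.const_mul _ ?_))
  rcases ht.eq_or_lt with rfl | ht
  · simp [fracInt]
  set B := 1 + R t
  refine intervalIntegral.tendsto_integral_filter_of_dominated_convergence
    (fun s => (t - s) ^ (β - 1) * (B * w s)) ?_ ?_ ?_ ?_
  · refine Eventually.of_forall fun n => ?_
    rw [uIoc_of_le ht.le]
    exact AEStronglyMeasurable.mul (Measurable.aestronglyMeasurable (by fun_prop))
      (((continuousOn_delayed hg (hYc _) _).mono Ioc_subset_Ioi_self).aestronglyMeasurable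
        measurableSet_Ioc)
  · refine Eventually.of_forall fun n => ae_of_all _ fun s hs => ?_
    rw [uIoc_of_le ht.le] at hs
    have h0 := Real.rpow_nonneg (sub_nonneg.2 hs.2) (β - 1)
    rw [norm_mul, Real.norm_of_nonneg h0]
    refine mul_le_mul_of_nonneg_left ((hgw s hs.1 _).trans ?_) h0
    rw [mul_comm]
    have hδ : 0 ≤ 1 / ((φ n : ℝ) + 1) := by positivity
    refine mul_le_mul_of_nonneg_right ?_ (hw.nonneg s hs.1)
    linarith [hYb (φ n) t ht (s - 1 / ((φ n : ℝ) + 1)) (by linarith [hs.2])]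
  · have hB : 0 ≤ R t := (abs_nonneg _).trans (hYb 0 t ht t le_rfl)
    refine hw.kernel_mul_intervalIntegrable (B := B) ht
      (continuousOn_const.mul hw.continuousOn) fun s hs => ?_
    rw [abs_of_nonneg (mul_nonneg (by positivity) (hw.nonneg s hs.1))]
  · refine ae_of_all _ fun s hs => ?_
    rw [uIoc_of_le ht.le] at hs
    refine Tendsto.const_mul _ ?_
    -- Locally uniform convergence permits evaluation at the moving point `s - 1 / (φ n + 1)`.
    have hshift : Tendsto (fun n => s - 1 / ((φ n : ℝ) + 1)) atTop (𝓝 s) := by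
      simpa using (tendsto_one_div_add_atTop_nhds_zero_nat.comp hφ.tendsto_atTop).const_sub s
    have h1 : Tendsto (fun n => Y (φ n) (s - 1 / ((φ n : ℝ) + 1))) atTop (𝓝 (y s)) :=
      hlim.tendsto_comp hy.continuousAt hshift
    have h2 : ContinuousAt (fun q : ℝ × ℝ => g q.1 q.2) (s, y s) :=
      hg.continuousAt ((isOpen_Ioi.prod isOpen_univ).mem_nhds ⟨hs.1, mem_univ _⟩)
    exact h2.tendsto.comp (tendsto_const_nhds.prodMk_nhds h1)

end AdmissibleWeight

/-! ### From the Volterra equation to the Riemann–Liouville derivative. -/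

lemma integral_beta_kernel {β r t : ℝ} (hβ : 0 < β) (hβ1 : β < 1) (hrt : r < t) :
    ∫ s in r..t, (t - s) ^ (-β) * (s - r) ^ (β - 1) = Real.Gamma β * Real.Gamma (1 - β) := by
  have ha : 0 < t - r := sub_pos.2 hrt
  -- The Beta parameters `β` and `1 - β` add up to `1`, so the power of `t - r` is trivial and the
  -- denominator is `Γ(1) = 1`.
  have h1 := Complex.betaIntegral_scaled (β : ℂ) ((1 - β : ℝ) : ℂ) ha
  rw [Complex.betaIntegral_eq_Gamma_mul_div _ _ (by simpa using hβ) (by simpa using hβ1),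
    ← Complex.ofReal_add, add_sub_cancel, Complex.ofReal_one, sub_self, Complex.cpow_zero,
    Complex.Gamma_one, div_one, one_mul, Complex.Gamma_ofReal, Complex.Gamma_ofReal,
    ← Complex.ofReal_mul] at h1
  have h2 : ∫ x in (0 : ℝ)..(t - r), (x : ℂ) ^ ((β : ℂ) - 1) *
      (((t - r : ℝ) : ℂ) - x) ^ (((1 - β : ℝ) : ℂ) - 1) =
      ((∫ x in (0 : ℝ)..(t - r), x ^ (β - 1) * (t - r - x) ^ (-β) : ℝ) : ℂ) := by
    rw [← intervalIntegral.integral_ofReal]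
    refine intervalIntegral.integral_congr fun x hx => ?_
    rw [uIcc_of_le ha.le] at hx
    rw [Complex.ofReal_mul, Complex.ofReal_cpow hx.1, Complex.ofReal_cpow (sub_nonneg.2 hx.2)]
    push_cast
    ring_nf
  rw [h2] at h1
  have h3 := Complex.ofReal_injective h1
  rw [← h3]
  have h4 := intervalIntegral.integral_comp_sub_right (a := r) (b := t)
    (fun x => x ^ (β - 1) * (t - r - x) ^ (-β)) r
  rw [sub_self] at h4
  rw [← h4]
  refine intervalIntegral.integral_congr fun s _ => ?_
  rw [mul_comm, show t - r - (s - r) = t - s by ring]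

/-- The integral of a non-integrable function is `0` by convention, whereas this one is a positive
product of Gamma values. -/
lemma intervalIntegrable_beta_kernel {β r t : ℝ} (hβ : 0 < β) (hβ1 : β < 1) (hrt : r < t) :
    IntervalIntegrable (fun s => (t - s) ^ (-β) * (s - r) ^ (β - 1)) volume r t := by
  by_contra h
  have h1 := integral_beta_kernel hβ hβ1 hrt
  rw [intervalIntegral.integral_undef h] at h1
  exact (mul_pos (Real.Gamma_pos_of_pos hβ) (Real.Gamma_pos_of_pos (sub_pos.2 hβ1))).ne h1

/-- The semigroup property `I^(1-β) I^β h = I^1 h`, without the Gamma factors. -/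
lemma fracInt_comp {β t : ℝ} (hβ : 0 < β) (hβ1 : β < 1) (ht : 0 < t) {h : ℝ → ℝ}
    (hi : IntegrableOn h (Ioc 0 t)) :
    IntervalIntegrable (fun s => (t - s) ^ (-β) * fracInt β h s) volume 0 t ∧
    ∫ s in (0 : ℝ)..t, (t - s) ^ (-β) * fracInt β h s =
      Real.Gamma β * Real.Gamma (1 - β) * ∫ s in (0 : ℝ)..t, h s := by
  set G := Real.Gamma β * Real.Gamma (1 - β)
  set k : ℝ × ℝ → ℝ := fun z => if z.2 < z.1 then (t - z.1) ^ (-β) * (z.1 - z.2) ^ (β - 1) else 0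
    with hk
  set ν := volume.restrict (Ioc 0 t)
  have hkm : Measurable k :=
    Measurable.ite (measurableSet_lt measurable_snd measurable_fst) (by fun_prop) measurable_const
  have hk0 : ∀ s r, s ≤ t → 0 ≤ k (s, r) := fun s r hs => by
    simp only [hk]
    split_ifs with hrs
    · exact mul_nonneg (Real.rpow_nonneg (sub_nonneg.2 hs) _)
        (Real.rpow_nonneg (sub_nonneg.2 hrs.le) _)
    · exact le_rfl
  have hsec : ∀ r, (fun s => k (s, r)) =
      (Ioi r).indicator fun s => (t - s) ^ (-β) * (s - r) ^ (β - 1) := fun r => by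
    ext s
    simp only [hk, indicator, mem_Ioi]
  have hinter : ∀ r ∈ Ioo 0 t, Ioi r ∩ Ioc 0 t = Ioc r t := fun r hr => by
    ext s
    simp only [mem_inter_iff, mem_Ioi, mem_Ioc]
    exact ⟨fun h => ⟨h.1, h.2.2⟩, fun h => ⟨h.1, hr.1.trans h.1, h.2⟩⟩
  have hsi : ∀ r ∈ Ioo 0 t, Integrable (fun s => k (s, r)) ν := fun r hr => by
    rw [hsec, integrable_indicator_iff measurableSet_Ioi, IntegrableOn,
      Measure.restrict_restrict measurableSet_Ioi, hinter r hr]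
    exact (intervalIntegrable_iff_integrableOn_Ioc_of_le hr.2.le).1
      (intervalIntegrable_beta_kernel hβ hβ1 hr.2)
  have hsv : ∀ r ∈ Ioo 0 t, ∫ s, k (s, r) ∂ν = G := fun r hr => by
    rw [hsec, integral_indicator measurableSet_Ioi,
      Measure.restrict_restrict measurableSet_Ioi, hinter r hr,
      ← intervalIntegral.integral_of_le hr.2.le]
    exact integral_beta_kernel hβ hβ1 hr.2
  have hν : ∀ᵐ r ∂ν, r ∈ Ioo 0 t := by
    have hne : ∀ᵐ s : ℝ ∂volume, s ≠ t := by simp [ae_iff, measure_singleton]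
    refine (ae_restrict_iff' measurableSet_Ioc).2 ?_
    filter_upwards [hne] with s hs hs' using ⟨hs'.1, lt_of_le_of_ne hs'.2 hs⟩
  have hνm : ∀ᵐ s ∂ν, s ∈ Ioc 0 t := ae_restrict_mem measurableSet_Ioc
  have hKm : AEStronglyMeasurable (fun z : ℝ × ℝ => k z * h z.2) (ν.prod ν) :=
    hkm.aestronglyMeasurable.mul hi.aestronglyMeasurable.comp_snd
  have hKi : Integrable (fun z : ℝ × ℝ => k z * h z.2) (ν.prod ν) := by
    -- Tonelli: integrating the nonnegative kernel over `s` first leaves `G * |h r|`, which is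
    -- integrable.
    rw [integrable_prod_iff' hKm]
    constructor
    · filter_upwards [hν] with r hr using (hsi r hr).mul_const _
    · refine (hi.norm.const_mul G).congr ?_
      filter_upwards [hν] with r hr
      rw [← hsv r hr, ← integral_mul_const]
      refine integral_congr_ae ?_
      filter_upwards [hνm] with s hs
      rw [norm_mul, Real.norm_of_nonneg (hk0 s r hs.2)]
  have hin : ∀ s ∈ Ioc 0 t, ∫ r, k (s, r) * h r ∂ν = (t - s) ^ (-β) * fracInt β h s := by
    intro s hs
    have e : (fun r => k (s, r) * h r) =
        (Iio s).indicator fun r => (t - s) ^ (-β) * ((s - r) ^ (β - 1) * h r) := by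
      ext r
      simp only [hk, indicator, mem_Iio]
      split_ifs <;> ring
    have e2 : Iio s ∩ Ioc 0 t = Ioo 0 s := by
      ext r
      simp only [mem_inter_iff, mem_Iio, mem_Ioc, mem_Ioo]
      exact ⟨fun h => ⟨h.2.1, h.1⟩, fun h => ⟨h.2, h.1, h.2.le.trans hs.2⟩⟩
    rw [e, integral_indicator measurableSet_Iio, Measure.restrict_restrict measurableSet_Iio, e2,
      integral_const_mul, ← integral_Ioc_eq_integral_Ioo, fracInt,
      intervalIntegral.integral_of_le hs.1.le]
  constructor
  · rw [intervalIntegrable_iff_integrableOn_Ioc_of_le ht.le]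
    refine hKi.integral_prod_left.congr ?_
    filter_upwards [hνm] with s hs using hin s hs
  · rw [intervalIntegral.integral_of_le ht.le, intervalIntegral.integral_of_le ht.le]
    calc ∫ s, (t - s) ^ (-β) * fracInt β h s ∂ν = ∫ s, ∫ r, k (s, r) * h r ∂ν ∂ν := by
          refine integral_congr_ae ?_
          filter_upwards [hνm] with s hs using (hin s hs).symm
      _ = ∫ r, ∫ s, k (s, r) * h r ∂ν ∂ν := integral_integral_swap hKi
      _ = ∫ r, G * h r ∂ν := by
          refine integral_congr_ae ?_
          filter_upwards [hν] with r hr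
          rw [integral_mul_const, hsv r hr]
      _ = _ := integral_const_mul _ _

/-- The fractional integral of order `1 - β` of a solution of the Volterra equation. -/
lemma rlIntegral_volterra {β x₀ : ℝ} (hβ : 0 < β) (hβ1 : β < 1) {x h : ℝ → ℝ}
    (hi : ∀ T, 0 < T → IntegrableOn h (Ioc 0 T))
    (hx : ∀ t, 0 < t → x t = x₀ * t ^ (β - 1) + 1 / Real.Gamma β * fracInt β h t)
    {t : ℝ} (ht : 0 < t) :
    rlIntegral (1 - β) x t = x₀ * Real.Gamma β + ∫ s in (0 : ℝ)..t, h s := by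
  obtain ⟨i1, e1⟩ := fracInt_comp hβ hβ1 ht (hi t ht)
  have i2 := intervalIntegrable_beta_kernel hβ hβ1 ht
  have e2 := integral_beta_kernel hβ hβ1 ht
  have hG := (Real.Gamma_pos_of_pos hβ).ne'
  have hG1 := (Real.Gamma_pos_of_pos (sub_pos.2 hβ1)).ne'
  have e : ∫ s in (0 : ℝ)..t, x s / (t - s) ^ (1 - (1 - β)) =
      ∫ s in (0 : ℝ)..t, x₀ * ((t - s) ^ (-β) * (s - 0) ^ (β - 1)) +
        1 / Real.Gamma β * ((t - s) ^ (-β) * fracInt β h s) := by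
    rw [intervalIntegral.integral_of_le ht.le, intervalIntegral.integral_of_le ht.le]
    refine setIntegral_congr_fun measurableSet_Ioc fun s hs => ?_
    rw [hx s hs.1, sub_sub_cancel, Real.rpow_neg (sub_nonneg.2 hs.2), sub_zero, div_eq_mul_inv]
    ring
  rw [rlIntegral, e, intervalIntegral.integral_add (i2.const_mul _) (i1.const_mul _),
    intervalIntegral.integral_const_mul, intervalIntegral.integral_const_mul, e1, e2]
  field_simp

/-- By the semigroup law `I^(1-β) x` is a constant plus the primitive of `h`. The extension takes
the value `x₀ * Γ(β)` at `0`. -/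
lemma hasRLDerivOn_volterra {β x₀ : ℝ} (hβ : 0 < β) (hβ1 : β < 1) {x h : ℝ → ℝ}
    (hxi : ∀ T, 0 < T → IntegrableOn x (Ioc 0 T)) (hc : ContinuousOn h (Ioi 0))
    (hi : ∀ T, 0 < T → IntegrableOn h (Ioc 0 T))
    (hx : ∀ t, 0 < t → x t = x₀ * t ^ (β - 1) + 1 / Real.Gamma β * fracInt β h t) :
    HasRLDerivOn β x h := by
  have hii : ∀ T, 0 < T → IntervalIntegrable h volume 0 T := fun T hT =>
    (intervalIntegrable_iff_integrableOn_Ioc_of_le hT.le).2 (hi T hT)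
  refine ⟨hxi, ⟨fun t => x₀ * Real.Gamma β + ∫ s in (0 : ℝ)..t, h s,
    fun t ht => (rlIntegral_volterra hβ hβ1 hi hx ht).symm, fun T hT => ?_⟩, fun t ht => ?_⟩
  · have hconst : AbsolutelyContinuousOnInterval (fun _ : ℝ => x₀ * Real.Gamma β) 0 T :=
      (LipschitzWith.const (x₀ * Real.Gamma β)).lipschitzOnWith.absolutelyContinuousOnInterval
    exact hconst.add ((hii T hT).absolutelyContinuousOnInterval_intervalIntegral left_mem_uIcc)
  · have hd : HasDerivAt (fun t => ∫ s in (0 : ℝ)..t, h s) (h t) t :=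
      intervalIntegral.integral_hasDerivAt_right (hii t ht)
        (hc.stronglyMeasurableAtFilter isOpen_Ioi t ht) (hc.continuousAt (Ioi_mem_nhds ht))
    refine (hd.const_add (x₀ * Real.Gamma β)).congr_of_eventuallyEq ?_
    filter_upwards [Ioi_mem_nhds ht] with s hs using rlIntegral_volterra hβ hβ1 hi hx hs

/-! ### Decay at infinity. -/

lemma half_rpow_neg_le {t e : ℝ} (ht : 0 < t) (he : e ≤ 1) :
    (t / 2) ^ (-e) ≤ 2 * t ^ (-e) := by
  have h2 : (2 : ℝ) ^ e ≤ 2 := by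
    simpa using Real.rpow_le_rpow_of_exponent_le (by norm_num : (1 : ℝ) ≤ 2) he
  calc (t / 2) ^ (-e) = 2 ^ e * t ^ (-e) := by
        rw [Real.div_rpow ht.le (by norm_num), Real.rpow_neg (by norm_num : (0 : ℝ) ≤ 2)]
        field_simp
    _ ≤ _ := by gcongr

lemma fracKernel_mul_rpow_neg_le {β γ s t : ℝ} (hβ : 0 < β) (hβ1 : β < 1) (hγ : 0 < γ)
    (hγ1 : γ < 1) (hs : 0 < s) (hst : s < t) :
    (t - s) ^ (β - 1) * s ^ (-γ) ≤
      2 * t ^ (-γ) * (t - s) ^ (β - 1) + 2 * t ^ (β - 1) * s ^ (-γ) := by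
  have ht : 0 < t := hs.trans hst
  have hts : 0 < t - s := sub_pos.2 hst
  have h1 : 0 ≤ (t - s) ^ (β - 1) := by positivity
  have h2 : 0 ≤ s ^ (-γ) := by positivity
  have h3 : 0 ≤ t ^ (-γ) := by positivity
  have h4 : 0 ≤ t ^ (β - 1) := by positivity
  rcases le_total (t / 2) s with h | h
  · have : s ^ (-γ) ≤ 2 * t ^ (-γ) :=
      (Real.rpow_le_rpow_of_nonpos (by positivity) h (by linarith)).trans
        (half_rpow_neg_le ht hγ1.le)
    nlinarith [mul_nonneg h4 h2]
  · have : (t - s) ^ (β - 1) ≤ 2 * t ^ (β - 1) := by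
      have h5 := half_rpow_neg_le (e := 1 - β) ht (by linarith)
      rw [neg_sub] at h5
      exact (Real.rpow_le_rpow_of_nonpos (by positivity) (by linarith) (by linarith)).trans h5
    nlinarith [mul_nonneg h3 h1]

/-- `fracKernel_mul_rpow_neg_le` splits the product at `t / 2`; the terms with `2 / β` and `2 / (1 -
γ)` come from the two separate singularities, and both scale like `t ^ (β - γ)`. -/
lemma abs_integral_fracKernel_tail_le {β γ A t : ℝ} (hβ : 0 < β) (hβ1 : β < 1) (hγ : 0 < γ)
    (hγ1 : γ < 1) (hA : 0 ≤ A) (ht : 1 ≤ t) {h : ℝ → ℝ}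
    (hh : ∀ s ∈ Icc 1 t, |h s| ≤ A * s ^ (-γ)) :
    |∫ s in (1 : ℝ)..t, (t - s) ^ (β - 1) * h s| ≤
      A * ((2 / β + 2 / (1 - γ)) * t ^ (β - γ)) := by
  have ht0 : 0 < t := by linarith
  have i1 := intervalIntegrable_sub_rpow (r := β - 1) (by linarith) t 1 t
  have i2 : IntervalIntegrable (fun s : ℝ => s ^ (-γ)) volume 1 t :=
    intervalIntegral.intervalIntegrable_rpow' (by linarith)
  have hne : ∀ᵐ s : ℝ ∂volume, s ≠ t := by simp [ae_iff, measure_singleton]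
  rw [← Real.norm_eq_abs]
  refine (intervalIntegral.norm_integral_le_of_norm_le ht ?_
    (((i1.const_mul (2 * t ^ (-γ))).add (i2.const_mul (2 * t ^ (β - 1)))).const_mul A)).trans ?_
  · filter_upwards [hne] with s hs hs'
    have hlt : s < t := lt_of_le_of_ne hs'.2 hs
    have hs0 : 0 < s := by linarith [hs'.1]
    have h0 := Real.rpow_nonneg (sub_nonneg.2 hs'.2) (β - 1)
    rw [norm_mul, Real.norm_of_nonneg h0]
    calc (t - s) ^ (β - 1) * ‖h s‖ ≤ (t - s) ^ (β - 1) * (A * s ^ (-γ)) :=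
          mul_le_mul_of_nonneg_left (hh s ⟨hs'.1.le, hs'.2⟩) h0
      _ = A * ((t - s) ^ (β - 1) * s ^ (-γ)) := by ring
      _ ≤ _ := mul_le_mul_of_nonneg_left
          (fracKernel_mul_rpow_neg_le hβ hβ1 hγ hγ1 hs0 hlt) hA
  · rw [intervalIntegral.integral_const_mul, intervalIntegral.integral_add (i1.const_mul _)
      (i2.const_mul _), intervalIntegral.integral_const_mul, intervalIntegral.integral_const_mul,
      integral_sub_rpow (by linarith), integral_rpow (Or.inl (by linarith)), sub_self,
      sub_add_cancel, Real.zero_rpow hβ.ne', sub_zero, Real.one_rpow]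
    refine mul_le_mul_of_nonneg_left ?_ hA
    have h1 : (t - 1) ^ β ≤ t ^ β := Real.rpow_le_rpow (by linarith) (by linarith) hβ.le
    have e1 : t ^ (-γ) * t ^ β = t ^ (β - γ) := by rw [← Real.rpow_add ht0]; ring_nf
    have e2 : t ^ (β - 1) * t ^ (-γ + 1) = t ^ (β - γ) := by rw [← Real.rpow_add ht0]; ring_nf
    have hg : 0 < 1 - γ := by linarith
    calc _ ≤ 2 * t ^ (-γ) * (t ^ β / β) + 2 * t ^ (β - 1) * (t ^ (-γ + 1) / (1 - γ)) := by
          rw [show -γ + 1 = 1 - γ by ring]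
          gcongr
          linarith
      _ = 2 / β * (t ^ (-γ) * t ^ β) + 2 / (1 - γ) * (t ^ (β - 1) * t ^ (-γ + 1)) := by ring
      _ = _ := by rw [e1, e2]; ring

/-- A continuous function on `[1, ∞)` bounded at each point by a vanishing perturbation of its
running maximum tends to `0`. -/
lemma tendsto_zero_of_le_running_bound {x e d : ℝ → ℝ} (hx : ContinuousOn x (Ici 1))
    (he : Tendsto e atTop (𝓝 0)) (hd : Tendsto d atTop (𝓝 0))
    (h : ∀ t m, 1 < t → 0 ≤ m → (∀ s ∈ Icc 1 t, |x s| ≤ m) → |x t| ≤ e t + d t * (2 + m)) :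
    Tendsto x atTop (𝓝 0) := by
  obtain ⟨T, hT⟩ := ((he.eventually (gt_mem_nhds one_pos)).and
    (hd.eventually (gt_mem_nhds (by norm_num : (0 : ℝ) < 1 / 2)))).exists_forall_of_atTop
  set T' := max T 2
  obtain ⟨m₀, hm₀⟩ := (isCompact_Icc (a := (1 : ℝ)) (b := T')).exists_bound_of_continuousOn
    (hx.mono Icc_subset_Ici_self)
  have hm₀0 : 0 ≤ m₀ := (norm_nonneg _).trans (hm₀ 1 ⟨le_rfl, by
    linarith [le_max_right T 2]⟩)
  have hbd : ∀ t, 1 ≤ t → |x t| ≤ max m₀ 4 := by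
    intro t ht
    obtain ⟨u, hu, hmax⟩ := (isCompact_Icc (a := (1 : ℝ)) (b := t)).exists_isMaxOn
      ⟨1, le_rfl, ht⟩ ((hx.mono Icc_subset_Ici_self).abs)
    refine (hmax (right_mem_Icc.2 ht)).trans ?_
    rcases le_or_gt u T' with h1 | h1
    · exact (hm₀ u ⟨hu.1, h1⟩).trans (le_max_left _ _)
    · refine le_trans ?_ (le_max_right _ _)
      -- At a maximum point `u` beyond `T'` the inequality reads `|x u| ≤ 1 + (2 + |x u|) / 2`,
      -- whence the bound `4`.
      have h2 := h u |x u| (by linarith [le_max_right T 2]) (abs_nonneg _)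
        fun s hs => hmax ⟨hs.1, hs.2.trans hu.2⟩
      have h3 := hT u ((le_max_left T 2).trans h1.le)
      nlinarith [abs_nonneg (x u), h3.1, h3.2]
  have hlim : Tendsto (fun t => e t + d t * (2 + max m₀ 4)) atTop (𝓝 0) := by
    simpa using he.add (hd.mul_const (2 + max m₀ 4))
  refine squeeze_zero_norm' ?_ hlim
  filter_upwards [eventually_gt_atTop 1] with t ht
  exact h t _ ht (by positivity) fun s hs => hbd s hs.1

/-- The past on `(0, 1]` contributes at most `(t - 1) ^ (β - 1)` times the `L^1` norm of `h`, which
vanishes since `β < 1`; the rest is the running-maximum term. -/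
lemma volterra_tendsto_zero {β γ κ K x₀ : ℝ} (hβ : 0 < β) (hβγ : β < γ) (hγ : γ < 1)
    (hκ : 0 ≤ κ) (hK : 0 ≤ K) {x h : ℝ → ℝ} (hxc : ContinuousOn x (Ioi 0))
    (hi : IntegrableOn h (Ioc 0 1))
    (hki : ∀ t, 0 < t → IntervalIntegrable (fun s => (t - s) ^ (β - 1) * h s) volume 0 t)
    (hx : ∀ t, 0 < t → x t = x₀ * t ^ (β - 1) + κ * fracInt β h t)
    (hh : ∀ t, 1 ≤ t → |h t| ≤ K * t ^ (-γ) * (2 + |x t|)) :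
    Tendsto x atTop (𝓝 0) := by
  have hβ1 : β < 1 := hβγ.trans hγ
  set I := ∫ s in Ioc 0 1, |h s|
  have hI : 0 ≤ I := setIntegral_nonneg measurableSet_Ioc fun _ _ => abs_nonneg _
  have hpow : Tendsto (fun t : ℝ => t ^ (β - 1)) atTop (𝓝 0) := by
    simpa using tendsto_rpow_neg_atTop (sub_pos.2 hβ1)
  have hpow1 : Tendsto (fun t : ℝ => (t - 1) ^ (β - 1)) atTop (𝓝 0) :=
    hpow.comp (tendsto_atTop_add_const_right _ (-1) tendsto_id)
  have hpow2 : Tendsto (fun t : ℝ => t ^ (β - γ)) atTop (𝓝 0) := by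
    simpa using tendsto_rpow_neg_atTop (sub_pos.2 hβγ)
  refine tendsto_zero_of_le_running_bound
    (e := fun t => |x₀| * t ^ (β - 1) + κ * ((t - 1) ^ (β - 1) * I))
    (d := fun t => κ * (K * ((2 / β + 2 / (1 - γ)) * t ^ (β - γ))))
    (hxc.mono (Ici_subset_Ioi.2 one_pos)) ?_ ?_ ?_
  · simpa using (hpow.const_mul |x₀|).add ((hpow1.mul_const I).const_mul κ)
  · simpa using ((hpow2.const_mul (2 / β + 2 / (1 - γ))).const_mul K).const_mul κ
  intro t m ht hm hxm
  have ht0 : 0 < t := by linarith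
  have hk := hki t ht0
  have i1 : IntervalIntegrable (fun s => (t - s) ^ (β - 1) * h s) volume 0 1 :=
    hk.mono_set (by rw [uIcc_of_le zero_le_one, uIcc_of_le ht0.le]
                    exact Icc_subset_Icc le_rfl ht.le)
  have i2 : IntervalIntegrable (fun s => (t - s) ^ (β - 1) * h s) volume 1 t :=
    hk.mono_set (by rw [uIcc_of_le ht.le, uIcc_of_le ht0.le]
                    exact Icc_subset_Icc zero_le_one le_rfl)
  have b1 : |∫ s in (0 : ℝ)..1, (t - s) ^ (β - 1) * h s| ≤ (t - 1) ^ (β - 1) * I := by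
    have hi' := (intervalIntegrable_iff_integrableOn_Ioc_of_le zero_le_one).2 hi
    rw [← Real.norm_eq_abs]
    refine (intervalIntegral.norm_integral_le_of_norm_le zero_le_one
      (ae_of_all _ fun s hs => ?_) (hi'.abs.const_mul ((t - 1) ^ (β - 1)))).trans ?_
    · have hs1 : 0 < t - s := by linarith [hs.2]
      rw [norm_mul, Real.norm_of_nonneg (by positivity)]
      exact mul_le_mul_of_nonneg_right (Real.rpow_le_rpow_of_nonpos (by linarith)
        (by linarith [hs.2]) (by linarith)) (abs_nonneg _)
    · rw [intervalIntegral.integral_const_mul, intervalIntegral.integral_of_le zero_le_one]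
  have b2 := abs_integral_fracKernel_tail_le (A := K * (2 + m)) hβ hβ1 (hβ.trans hβγ) hγ
    (by positivity) ht.le (h := h) fun s hs => by
      have hs0 : 0 < s := by linarith [hs.1]
      calc |h s| ≤ K * s ^ (-γ) * (2 + |x s|) := hh s hs.1
        _ ≤ K * s ^ (-γ) * (2 + m) := by
            gcongr
            exact hxm s hs
        _ = _ := by ring
  rw [hx t ht0, fracInt, ← intervalIntegral.integral_add_adjacent_intervals i1 i2]
  refine (abs_add_le _ _).trans ?_
  rw [abs_mul, abs_mul, abs_of_nonneg hκ, abs_of_nonneg (Real.rpow_nonneg ht0.le (β - 1))]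
  have b3 := mul_le_mul_of_nonneg_left ((abs_add_le _ _).trans (add_le_add b1 b2)) hκ
  linarith

/-! ### Application to the initial value problem. -/

lemma rpow_le_one_add {u μ : ℝ} (hu : 0 ≤ u) (hμ0 : 0 ≤ μ) (hμ1 : μ ≤ 1) : u ^ μ ≤ 1 + u := by
  rcases le_total u 1 with h | h
  · linarith [Real.rpow_le_one hu h hμ0]
  · have := Real.rpow_le_rpow_of_exponent_le h hμ1
    rw [Real.rpow_one] at this
    linarith

/-- The weight `t ^ (β - 1) M(t)` is admissible for `M` continuous and locally in `L^p`,
`p > 1 / β`. -/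
lemma admissibleWeight_of_contLpLoc {β p : ℝ} (hβ : 0 < β) (hβ1 : β < 1) (hp : 1 / β < p)
    {M : ℝ → ℝ} (hM0 : ∀ t, 0 < t → 0 ≤ M t) (hM : M ∈ ContLpLoc p) :
    AdmissibleWeight β ((β + 1 / p) / 2) ((β + 1 / p) / 2 - 1 / p)
      (fun t => t ^ (β - 1) * M t) := by
  have hp1 : 1 < p := ((one_lt_div hβ).2 hβ1).trans hp
  have hp0 : 0 < p := by linarith
  have hpβ : 1 / p < β := (one_div_lt hβ hp0).1 hp
  have hpp : 0 < 1 / p := by positivity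
  -- The order is the midpoint of `1 / p` and `β`, leaving room on both sides: `a > 1 / p` for
  -- Hölder, `a < β` for the exponential bound.
  have key := fun T (hT : 0 < T) => weighted_fracInt_bound (a := (β + 1 / p) / 2) (b := β) hp1
    (by linarith) (by linarith) hβ1 hM0 (hM.2 T hT)
  refine ⟨by positivity, by linarith, hβ1, by linarith,
    fun s hs => mul_nonneg (Real.rpow_nonneg hs.le _) (hM0 s hs), ?_, ?_, ?_, ?_⟩
  · exact ContinuousOn.mul (fun t ht => (Real.continuousAt_rpow_const t _
      (Or.inl (ne_of_gt ht))).continuousWithinAt) hM.1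
  · intro T hT
    obtain ⟨C, -, h⟩ := key T hT
    exact (h T hT le_rfl).2.1
  · intro T hT
    obtain ⟨C, -, h⟩ := key T hT
    exact (h T hT le_rfl).1
  · intro T hT
    obtain ⟨C, hC, h⟩ := key T hT
    exact ⟨C, hC, fun t ht htT => (h t ht htT).2.2⟩

theorem theorem3p8 (β γ μ p K x₀ : ℝ) (hβ : 0 < β) (hβγ : β < γ) (hγ : γ < 1)
    (hμ0 : 0 ≤ μ) (hμ1 : μ ≤ 1) (hp : 1 / β < p) (hK : 0 ≤ K)
    (l k : ℝ → ℝ)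
    (hl0 : ∀ t : ℝ, 0 < t → 0 ≤ l t) (hk0 : ∀ t : ℝ, 0 < t → 0 ≤ k t)
    (hl : (fun t : ℝ => t ^ ((1 - μ) * (1 - β)) * l t) ∈ ContLpLoc p)
    (hk : (fun t : ℝ => t ^ (1 - β) * k t) ∈ ContLpLoc p)
    (hlK : ∀ t : ℝ, 1 ≤ t → t ^ γ * l t ≤ K)
    (hkK : ∀ t : ℝ, 1 ≤ t → t ^ γ * k t ≤ K)
    (f : ℝ → ℝ → ℝ)
    (hf : ContinuousOn (fun q : ℝ × ℝ => f q.1 q.2) (Ioi 0 ×ˢ univ))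
    (hbound : ∀ t : ℝ, 0 < t → ∀ x : ℝ, |f t x| ≤ l t * |x| ^ μ + k t) :
    ∃ x : ℝ → ℝ, x ∈ WeightedC (1 - β) ∧ IsRLSolution β f x₀ x ∧
      Tendsto x atTop (𝓝 0) := by
  have hβ1 : β < 1 := hβγ.trans hγ
  -- This is `M`: multiplied by `t ^ (β - 1)` it becomes `(t ^ (β - 1)) ^ μ * l t + k t`, the
  -- coefficients of the growth bound after the substitution.
  have hM0 : ∀ t, 0 < t → 0 ≤ t ^ ((1 - μ) * (1 - β)) * l t + t ^ (1 - β) * k t := fun t ht => by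
    have := hl0 t ht
    have := hk0 t ht
    positivity
  have hw := admissibleWeight_of_contLpLoc hβ hβ1 hp hM0
    ⟨hl.1.add hk.1, fun T hT => (hl.2 T hT).add (hk.2 T hT)⟩
  have hpowc : ContinuousOn (fun t : ℝ => t ^ (β - 1)) (Ioi 0) := fun t ht =>
    (Real.continuousAt_rpow_const t _ (Or.inl (ne_of_gt ht))).continuousWithinAt
  have hg : ContinuousOn (fun q : ℝ × ℝ => f q.1 (q.1 ^ (β - 1) * q.2)) (Ioi 0 ×ˢ univ) := by
    refine hf.comp (f := fun q : ℝ × ℝ => (q.1, q.1 ^ (β - 1) * q.2)) ?_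
      fun q hq => ⟨hq.1, mem_univ _⟩
    exact continuousOn_fst.prodMk
      ((hpowc.comp continuousOn_fst fun q hq => hq.1).mul continuousOn_snd)
  have hgw : ∀ s, 0 < s → ∀ y, |f s (s ^ (β - 1) * y)| ≤
      s ^ (β - 1) * (s ^ ((1 - μ) * (1 - β)) * l s + s ^ (1 - β) * k s) * (1 + |y|) := by
    intro s hs y
    have hls := hl0 s hs
    have hks := hk0 s hs
    have e1 : s ^ (β - 1) * s ^ ((1 - μ) * (1 - β)) = (s ^ (β - 1)) ^ μ := by
      rw [← Real.rpow_add hs, ← Real.rpow_mul hs.le]; ring_nf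
    have e2 : s ^ (β - 1) * s ^ (1 - β) = 1 := by rw [← Real.rpow_add hs]; simp
    have e3 : |s ^ (β - 1) * y| ^ μ = (s ^ (β - 1)) ^ μ * |y| ^ μ := by
      rw [abs_mul, abs_of_nonneg (Real.rpow_nonneg hs.le _),
        Real.mul_rpow (Real.rpow_nonneg hs.le _) (abs_nonneg _)]
    have h1 := rpow_le_one_add (abs_nonneg y) hμ0 hμ1
    calc |f s (s ^ (β - 1) * y)| ≤ l s * |s ^ (β - 1) * y| ^ μ + k s := hbound s hs _
      _ = (s ^ (β - 1)) ^ μ * l s * |y| ^ μ + k s * 1 := by rw [e3]; ring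
      _ ≤ (s ^ (β - 1)) ^ μ * l s * (1 + |y|) + k s * (1 + |y|) := by
          have := abs_nonneg y
          gcongr
          linarith
      _ = (s ^ (β - 1) * s ^ ((1 - μ) * (1 - β)) * l s + s ^ (β - 1) * s ^ (1 - β) * k s) *
            (1 + |y|) := by rw [e1, e2]; ring
      _ = _ := by ring
  obtain ⟨y, hy, hye⟩ := hw.exists_volterra_solution (κ := 1 / Real.Gamma β)
    (one_div_pos.2 (Real.Gamma_pos_of_pos hβ)).le x₀ hg hgw
  set x : ℝ → ℝ := fun t => t ^ (β - 1) * y t with hxdef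
  set h : ℝ → ℝ := fun t => f t (x t) with hhdef
  have hyx : ∀ t, 0 < t → y t = t ^ (1 - β) * x t := fun t ht => by
    simp only [hxdef]
    rw [← mul_assoc, ← Real.rpow_add ht]
    simp
  have hxc : ContinuousOn x (Ioi 0) := hpowc.mul hy.continuousOn
  have hhc : ContinuousOn h (Ioi 0) :=
    hf.comp (f := fun t => (t, x t)) (continuousOn_id.prodMk hxc) fun t ht => ⟨ht, mem_univ _⟩
  have hxe : ∀ t, 0 < t → x t = x₀ * t ^ (β - 1) + 1 / Real.Gamma β * fracInt β h t := by
    intro t ht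
    have e : t ^ (β - 1) * t ^ (1 - β) = 1 := by rw [← Real.rpow_add ht]; simp
    have h1 : x t = t ^ (β - 1) * y t := rfl
    rw [h1, hye t ht.le]
    linear_combination (1 / Real.Gamma β * fracInt β h t) * e
  have hyb : ∀ T : ℝ, 0 < T → ∃ R, 0 ≤ R ∧ ∀ s ∈ Ioc 0 T, |y s| ≤ R := fun T hT => by
    obtain ⟨R, hR⟩ := (isCompact_Icc (a := (0 : ℝ)) (b := T)).exists_bound_of_continuousOn
      hy.continuousOn
    exact ⟨R, (norm_nonneg _).trans (hR 0 ⟨le_rfl, hT.le⟩), fun s hs => hR s ⟨hs.1.le, hs.2⟩⟩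
  have hdom : ∀ T : ℝ, 0 < T → ∃ B, ∀ s ∈ Ioc 0 T, |h s| ≤
      B * (s ^ (β - 1) * (s ^ ((1 - μ) * (1 - β)) * l s + s ^ (1 - β) * k s)) := fun T hT => by
    obtain ⟨R, -, hR⟩ := hyb T hT
    refine ⟨1 + R, fun s hs => (hgw s hs.1 (y s)).trans ?_⟩
    rw [mul_comm]
    exact mul_le_mul_of_nonneg_right (by linarith [hR s hs]) (hw.nonneg s hs.1)
  have hhi : ∀ T, 0 < T → IntegrableOn h (Ioc 0 T) := fun T hT => by
    obtain ⟨B, hB⟩ := hdom T hT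
    refine Integrable.mono' ((hw.integrableOn T hT).const_mul B)
      ((hhc.mono Ioc_subset_Ioi_self).aestronglyMeasurable measurableSet_Ioc) ?_
    exact (ae_restrict_iff' measurableSet_Ioc).2 (ae_of_all _ hB)
  have hxi : ∀ T, 0 < T → IntegrableOn x (Ioc 0 T) := fun T hT => by
    have h1 := (intervalIntegrable_iff_integrableOn_Ioc_of_le hT.le).1
      (intervalIntegral.intervalIntegrable_rpow' (a := 0) (b := T) (r := β - 1) (by linarith))
    obtain ⟨R, hR0, hR⟩ := hyb T hT
    refine Integrable.mono' (h1.mul_const R)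
      ((hxc.mono Ioc_subset_Ioi_self).aestronglyMeasurable measurableSet_Ioc) ?_
    refine (ae_restrict_iff' measurableSet_Ioc).2 (ae_of_all _ fun s hs => ?_)
    have h2 := Real.rpow_nonneg hs.1.le (β - 1)
    rw [hxdef, norm_mul, Real.norm_of_nonneg h2]
    exact mul_le_mul_of_nonneg_left (hR s hs) h2
  refine ⟨x, ⟨hxc, y, hy.continuousOn, hyx⟩,
    ⟨hasRLDerivOn_volterra hβ hβ1 hxi hhc hhi hxe, ?_⟩, ?_⟩
  · have hy0 : y 0 = x₀ := by
      rw [hye 0 le_rfl, Real.zero_rpow (by linarith : 1 - β ≠ 0)]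
      ring
    have h1 : Tendsto y (𝓝[>] 0) (𝓝 x₀) := hy0 ▸ (hy.tendsto 0).mono_left nhdsWithin_le_nhds
    refine h1.congr' ?_
    filter_upwards [self_mem_nhdsWithin] with t ht using hyx t ht
  · refine volterra_tendsto_zero hβ hβγ hγ (one_div_pos.2 (Real.Gamma_pos_of_pos hβ)).le hK hxc
      (hhi 1 one_pos) (fun t ht => ?_) hxe fun t ht => ?_
    · obtain ⟨B, hB⟩ := hdom t ht
      exact hw.kernel_mul_intervalIntegrable ht hhc hB
    · have ht0 : 0 < t := by linarith
      have e : t ^ (-γ) * t ^ γ = 1 := by rw [← Real.rpow_add ht0]; simp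
      have hpos : 0 ≤ t ^ (-γ) := Real.rpow_nonneg ht0.le _
      have hbd : ∀ u, t ^ γ * u ≤ K → u ≤ K * t ^ (-γ) := fun u hu => by
        calc u = t ^ (-γ) * (t ^ γ * u) := by rw [← mul_assoc, e, one_mul]
          _ ≤ t ^ (-γ) * K := by gcongr
          _ = _ := mul_comm _ _
      have h1 := hbd _ (hlK t ht)
      have h2 := hbd _ (hkK t ht)
      have h3 := rpow_le_one_add (abs_nonneg (x t)) hμ0 hμ1
      calc |h t| ≤ l t * |x t| ^ μ + k t := hbound t ht0 _
        _ ≤ K * t ^ (-γ) * (1 + |x t|) + K * t ^ (-γ) := by gcongr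
        _ = _ := by ring
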